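/- Let $n\ge 3$ and $0<\mu\le\overline v$. A single item is sold to $n$ bidders whose values are i.i.d. from a distribution $F$. Let $\mathcal F$ be the set of probability distributions on $[0,\overline v]$ with mean $\mu$, and let $\mathcal Q$ be the set of probability distributions on $[0,\overline v]$. In the second-price auction with reserve $r$, a highest bidder (ties broken arbitrarily) receives the item if and only if her bid strictly exceeds $r$, and then pays the maximum of $r$ and the highest bid of the other bidders; all other payments are $0$. Bidders bid their values. Let $\mathrm{Rev}_F(r)$ be the expected total payment when the values are i.i.d. from $F$, and let $\mathrm{Rev}_F(Q)=\mathbb E_{r\sim Q}[\mathrm{Rev}_F(r)]$. In the reduced zero-sum game the seller chooses $Q\in\mathcal Q$ to maximize, and the adversary chooses $F\in\mathcal F$ to minimize, $\mathrm{Rev}_F(Q)$. The equation $$\Bigl(n-\tfrac1{n-1}+\log\tfrac{\overline v}{x}\Bigr)x=(n-1)^2\mu$$ has exactly two solutions $x>0$; let $\underline v$ be the smaller one. Then the pair $(Q^*,F^*)$ of distributions with the following cumulative distribution functions is well defined, lies in $\mathcal Q\times\mathcal F$, and is an equilibrium of the reduced game, i.e. $\mathrm{Rev}_{F^*}(Q)\le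 \mathrm{Rev}_{F^*}(Q^*)\le \mathrm{Rev}_{F}(Q^*)$ for all $Q\in\mathcal Q$ and $F\in\mathcal F$; moreover $Q^*$ maximizes $\inf_{F\in\mathcal F}\mathrm{Rev}_F(Q)$ over $Q\in\mathcal Q$, and $F^*$ minimizes $\sup_{Q\in\mathcal Q}\mathrm{Rev}_F(Q)$ over $F\in\mathcal F$. (1) If $\underline v\le\overline v$: with $v_0=\frac{\underline v}{n-1}$, $$F^*(v)=\begin{cases}0 & v<v_0,\\ 1-\frac1{(n-1)^2} & v_0\le v<\underline v,\\ 1-\frac{v_0}{(n-1)v} & \underline v\le v<\overline v,\\ 1 & v\ge\overline v,\end{cases}$$ and, with $c=n-1-\frac1{n-1}$, $$Q^*(r)=\begin{cases}0 & r<0,\\ \Bigl(1-\frac{v_0}{(n-1)\overline v}\Bigr)^{n-1}\Bigl(\frac{(n-1)^2}{(n-1)^2-1}\Bigr)^{n-1}\frac{c}{c+\log(\overline v/\underline v)} & 0\le r<\underline v,\\ \Bigl(1-\frac{v_0}{(n-1)\overline v}\Bigr)^{n-1}\Bigl(\frac{(n-1)r}{(n-1)r-v_0}\Bigr)^{n-1}\frac{c+\log(r/\underline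 v)}{c+\log(\overline v/\underline v)} & \underline v\le r\le\overline v,\\ 1 & r>\overline v.\end{cases}$$ (2) If $\underline v\ge\overline v$: with $v_0=\mu-\frac{\overline v-\mu}{(n-1)^2-1}$, $$F^*(v)=\begin{cases}0 & v<v_0,\\ 1-\frac1{(n-1)^2} & v_0\le v<\overline v,\\ 1 & v\ge\overline v,\end{cases}\qquad Q^*(r)=\begin{cases}0 & r<0,\\ 1 & r\ge 0.\end{cases}$$ -/

import Mathlib

open MeasureTheory ProbabilityTheory Set

noncomputable section

namespace RobustAuction

/-- Value distributions compatible with mean `m` and upper bound `vbar`: Borel probability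
measures concentrated on `[0, vbar]` with expectation `m`. -/
def Compatible (m vbar : ℝ) : Set (Measure ℝ) :=
  {F | IsProbabilityMeasure F ∧ F (Icc 0 vbar)ᶜ = 0 ∧ ∫ v, v ∂F = m}

/-- Reserve-price distributions: Borel probability measures concentrated on `[0, vbar]`. -/
def Reserves (vbar : ℝ) : Set (Measure ℝ) :=
  {Q | IsProbabilityMeasure Q ∧ Q (Icc 0 vbar)ᶜ = 0}

/-- `winner` is a tie-breaking rule: it selects a highest bidder for every bid profile. -/
def IsTieBreaking {n : ℕ} (winner : (Fin n → ℝ) → Fin n) : Prop :=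
  ∀ (b : Fin n → ℝ) (i : Fin n), b i ≤ b (winner b)

/-- Payment of bidder `i` in the second-price auction with reserve `r` at the bid profile `b`:
the selected highest bidder gets the item if her bid strictly exceeds `r`, and then pays the
maximum of `r` and the highest bid of the others; every other payment is zero. -/
def payment {n : ℕ} (winner : (Fin n → ℝ) → Fin n) (r : ℝ) (b : Fin n → ℝ) (i : Fin n) : ℝ :=
  if i = winner b ∧ r < b i then max r (⨆ j : {j : Fin n // j ≠ i}, b j) else 0

/-- Expected revenue with the fixed reserve `r` when the `n` values are i.i.d. from `F`. -/
def revenueAt {n : ℕ} (winner : (Fin n → ℝ) → Fin n) (F : Measure ℝ) (r : ℝ) : ℝ :=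
  ∫ v : Fin n → ℝ, ∑ i, payment winner r v i ∂(Measure.pi fun _ => F)

/-- Expected revenue when the reserve is drawn from `Q`. -/
def revenue {n : ℕ} (winner : (Fin n → ℝ) → Fin n) (F Q : Measure ℝ) : ℝ :=
  ∫ r, revenueAt winner F r ∂Q

/-- `(Q, F)` is an equilibrium (saddle point) of the reduced zero-sum game, in which the seller
maximizes and the adversary minimizes the expected revenue. -/
structure IsEquilibrium {n : ℕ} (winner : (Fin n → ℝ) → Fin n) (m vbar : ℝ)
    (Q F : Measure ℝ) : Prop where
  seller_mem : Q ∈ Reserves vbar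
  adversary_mem : F ∈ Compatible m vbar
  seller_best : ∀ Q' ∈ Reserves vbar, revenue winner F Q' ≤ revenue winner F Q
  adversary_best : ∀ F' ∈ Compatible m vbar, revenue winner F Q ≤ revenue winner F' Q

/-- The worst-case revenue that the seller guarantees by playing `Q`. -/
def guarantee {n : ℕ} (winner : (Fin n → ℝ) → Fin n) (m vbar : ℝ) (Q : Measure ℝ) : ℝ :=
  ⨅ F : Compatible m vbar, revenue winner F Q

/-- The best revenue that the seller can get against `F`. -/
def exposure {n : ℕ} (winner : (Fin n → ℝ) → Fin n) (vbar : ℝ) (F : Measure ℝ) : ℝ :=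
  ⨆ Q : Reserves vbar, revenue winner F Q

/-- `Q` is a max-min strategy of the seller and `F` a min-max strategy of the adversary. -/
structure SolvesReducedProblem {n : ℕ} (winner : (Fin n → ℝ) → Fin n) (m vbar : ℝ)
    (Q F : Measure ℝ) : Prop where
  seller_mem : Q ∈ Reserves vbar
  adversary_mem : F ∈ Compatible m vbar
  seller_maxmin : ∀ Q' ∈ Reserves vbar, guarantee winner m vbar Q' ≤ guarantee winner m vbar Q
  adversary_minmax : ∀ F' ∈ Compatible m vbar, exposure winner vbar F ≤ exposure winner vbar F'

/-- The positive solutions `x` of `(n - 1/(n-1) + log (vbar/x)) x = (n-1)² m`. -/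
def thresholdSolutions (n : ℕ) (m vbar : ℝ) : Set ℝ :=
  {x | 0 < x ∧
    ((n : ℝ) - 1 / ((n : ℝ) - 1) + Real.log (vbar / x)) * x = ((n : ℝ) - 1) ^ 2 * m}

/-- The adversary's distribution function when the threshold `vlow` is at most `vbar`. -/
def cdfFLow (n : ℕ) (vbar vlow v : ℝ) : ℝ :=
  let v₀ : ℝ := vlow / ((n : ℝ) - 1)
  if v < v₀ then 0
  else if v < vlow then 1 - 1 / ((n : ℝ) - 1) ^ 2
  else if v < vbar then 1 - v₀ / (v * ((n : ℝ) - 1))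
  else 1

/-- The seller's distribution function when the threshold `vlow` is at most `vbar`. -/
def cdfQLow (n : ℕ) (vbar vlow r : ℝ) : ℝ :=
  let v₀ : ℝ := vlow / ((n : ℝ) - 1)
  let c : ℝ := (n : ℝ) - 1 - 1 / ((n : ℝ) - 1)
  if r < 0 then 0
  else if r < vlow then
    (1 - v₀ / (vbar * ((n : ℝ) - 1))) ^ (n - 1)
      * (((n : ℝ) - 1) ^ 2 / (((n : ℝ) - 1) ^ 2 - 1)) ^ (n - 1)
      * (c / (c + Real.log (vbar / vlow)))
  else if r ≤ vbar then
    (1 - v₀ / (vbar * ((n : ℝ) - 1))) ^ (n - 1)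
      * (((n : ℝ) - 1) * r / (((n : ℝ) - 1) * r - v₀)) ^ (n - 1)
      * ((c + Real.log (r / vlow)) / (c + Real.log (vbar / vlow)))
  else 1

/-- The adversary's distribution function when the threshold is at least `vbar`. -/
def cdfFHigh (n : ℕ) (m vbar v : ℝ) : ℝ :=
  let v₀ : ℝ := m - (vbar - m) / (((n : ℝ) - 1) ^ 2 - 1)
  if v < v₀ then 0
  else if v < vbar then 1 - 1 / ((n : ℝ) - 1) ^ 2
  else 1

/-- The seller's distribution function when the threshold is at least `vbar`: reserve zero. -/
def cdfQHigh (r : ℝ) : ℝ := if r < 0 then 0 else 1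

end RobustAuction

end

/-! ### Revenue at a fixed reserve in terms of the distribution function -/

namespace RobustAuction

/-! Write `k = n - 1`. Revenue depends on `F` only through its distribution function: a sale yields
`r` plus the excess of the second-highest bid over `r`, and a layer-cake integral turns that excess
into `secondTail k (cdf F x)` (`revenueAt_eq`). Averaging over the reserve and applying Fubini gives
`revenue_eq`.

Both regimes belong to one family. The adversary mixes an atom at `v₀`, an equal-revenue density on
`(w, b]` and an atom at `b`; the seller mixes an atom at `0` with a density on `(w, b]`. The low
regime has `w = vlow` and `v₀ = w / k`. The high regime has `w = b = vbar`, with `v₀` fixed by the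
mean, and the seller's law collapses to reserve `0`.

Adversary's side: the mean is linear in the distribution function, so a Lagrange multiplier turns
revenue into the integral over `x` of a function of `y = cdf F x` alone (`revenue_sellerMeasure`).
By the identity `lagrangian_sub`, its excess over the value at the prescribed `u` is a nonnegative
combination of `secondTail` terms in `y / u` that vanish at `y = u`. Below `w` the value `y = 0` is
a second minimizer, so the adversary may jump from `0` to `1 - 1/k²` at any `v₀`, and the mean
determines where.

Seller's side: the equal-revenue part makes revenue constant on `[w, b)`
(`hasDerivAt_mul_one_sub_pow`). Reserves in `[v₀, w)` earn no more than this, and reserves below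
`v₀` earn more by a positive multiple of `k v₀ - w` (`gameValue_eq`). Hence `w ≤ k v₀` makes reserve
`0` optimal, and equality makes the whole support of the seller's law optimal.

For `v₀ = w / k` the mean condition is the threshold equation. Its left side is strictly concave
with maximum above `k² m` (`sq_lt_exp`), hence two roots; `vbar ≤ vlow` puts `vbar` on the rising
branch, which yields `vbar ≤ k v₀`. -/

/-- The probability that at least two of `k + 1` independent draws exceed a level whose
distribution function value is `y`. -/
def secondTail (k : ℕ) (y : ℝ) : ℝ := 1 - (k + 1) * y ^ k + k * y ^ (k + 1)

/-- Profiles at which at least two coordinates exceed `x`. -/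
def twoAbove {n : ℕ} (x : ℝ) : Set (Fin n → ℝ) := {v | ∃ i j, i ≠ j ∧ x < v i ∧ x < v j}

theorem sum_payment {n : ℕ} (winner : (Fin n → ℝ) → Fin n) (r : ℝ) (b : Fin n → ℝ) :
    ∑ i, payment winner r b i =
      if r < b (winner b) then max r (⨆ j : {j : Fin n // j ≠ winner b}, b j) else 0 := by
  rw [Finset.sum_eq_single (winner b)]
  · simp [payment]
  · intro i _ hi
    simp [payment, hi]
  · simp

theorem nonempty_ne {n : ℕ} (hn : 2 ≤ n) (i : Fin n) : Nonempty {j : Fin n // j ≠ i} := by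
  have : Nontrivial (Fin n) := Fin.nontrivial_iff_two_le.2 hn
  obtain ⟨j, hj⟩ := exists_ne i
  exact ⟨⟨j, hj⟩⟩

/-- The winner bids highest, so any other bid above `x` puts the winner above `x` too; conversely,
of two bids above `x` at most one is the winner's. The right side no longer mentions the
tie-breaking rule. -/
theorem lt_iSup_ne_winner_iff {n : ℕ} (hn : 2 ≤ n) {winner : (Fin n → ℝ) → Fin n}
    (hw : IsTieBreaking winner) (b : Fin n → ℝ) (x : ℝ) :
    x < (⨆ j : {j : Fin n // j ≠ winner b}, b j) ↔ b ∈ twoAbove x := by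
  have := nonempty_ne hn (winner b)
  rw [lt_ciSup_iff (Set.finite_range _).bddAbove]
  constructor
  · rintro ⟨⟨j, hj⟩, hx⟩
    exact ⟨j, winner b, hj, hx, hx.trans_le (hw b j)⟩
  · rintro ⟨i, j, hij, hi, hj⟩
    by_cases h : i = winner b
    · exact ⟨⟨j, fun h' => hij (h.trans h'.symm)⟩, hj⟩
    · exact ⟨⟨i, h⟩, hi⟩

theorem iSup_ne_winner_le {n : ℕ} (hn : 2 ≤ n) {winner : (Fin n → ℝ) → Fin n}
    (hw : IsTieBreaking winner) (b : Fin n → ℝ) :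
    (⨆ j : {j : Fin n // j ≠ winner b}, b j) ≤ b (winner b) := by
  have := nonempty_ne hn (winner b)
  exact ciSup_le fun j => hw b j

/-- With `s` the second-highest bid, `max r s = r + (s - r)⁺`, and `(s - r)⁺` is the length of the
set of levels `x` in `(r, vbar]` lying below `s`. Without a sale, `s ≤ r` and both terms vanish. -/
theorem sum_payment_eq {n : ℕ} (hn : 2 ≤ n) {winner : (Fin n → ℝ) → Fin n}
    (hw : IsTieBreaking winner) {r vbar : ℝ} {b : Fin n → ℝ}
    (hb : ∀ i, b i ≤ vbar) :
    ∑ i, payment winner r b i =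
      ({v : Fin n → ℝ | ∃ i, r < v i}.indicator (fun _ => r) b) +
        ∫ x in Ioc r vbar, (twoAbove x).indicator (fun _ => (1 : ℝ)) b := by
  rw [sum_payment]
  set s := ⨆ j : {j : Fin n // j ≠ winner b}, b j with hs
  have hsw : s ≤ b (winner b) := iSup_ne_winner_le hn hw b
  have hsv : s ≤ vbar := hsw.trans (hb _)
  have hind : ∀ x, (twoAbove x).indicator (fun _ => (1 : ℝ)) b =
      (Iio s).indicator (fun _ => (1 : ℝ)) x := by
    intro x
    classical
    simp only [indicator_apply, ← lt_iSup_ne_winner_iff hn hw, mem_Iio, ← hs]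
  simp_rw [hind]
  rw [integral_indicator measurableSet_Iio, Measure.restrict_restrict measurableSet_Iio]
  have hint : ∫ _ in Iio s ∩ Ioc r vbar, (1 : ℝ) = max r s - r := by
    have : Iio s ∩ Ioc r vbar = Ioo r s := by
      ext x
      simp only [mem_inter_iff, mem_Iio, mem_Ioc, mem_Ioo]
      constructor
      · rintro ⟨h1, h2, h3⟩; exact ⟨h2, h1⟩
      · rintro ⟨h1, h2⟩; exact ⟨h2, h1, h2.le.trans hsv⟩
    rw [this, setIntegral_const]
    simp only [smul_eq_mul, mul_one, Measure.real, Real.volume_Ioo]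
    rcases le_total r s with h | h
    · rw [ENNReal.toReal_ofReal (by linarith), max_eq_right h]
    · rw [ENNReal.ofReal_of_nonpos (by linarith), max_eq_left h]; simp
  rw [hint]
  by_cases h : r < b (winner b)
  · rw [if_pos h, indicator_of_mem (show b ∈ {v : Fin n → ℝ | ∃ i, r < v i} from ⟨_, h⟩)]
    ring
  · have h1 : b ∉ {v : Fin n → ℝ | ∃ i, r < v i} := by
      rintro ⟨i, hi⟩
      exact h (hi.trans_le (hw b i))
    rw [if_neg h, indicator_of_notMem h1, max_eq_left (hsw.trans (not_lt.1 h))]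
    ring

theorem measurableSet_twoAbove_prod {n : ℕ} :
    MeasurableSet {z : (Fin n → ℝ) × ℝ | z.1 ∈ twoAbove z.2} := by
  have : {z : (Fin n → ℝ) × ℝ | z.1 ∈ twoAbove z.2} =
      ⋃ i, ⋃ j, ⋃ _ : i ≠ j, {z | z.2 < z.1 i} ∩ {z | z.2 < z.1 j} := by
    ext z; simp only [twoAbove, mem_ofPred_eq, mem_iUnion, mem_inter_iff, exists_prop]
  rw [this]
  refine MeasurableSet.iUnion fun i => MeasurableSet.iUnion fun j => MeasurableSet.iUnion fun _ => ?_
  exact (measurableSet_lt (by fun_prop) (by fun_prop)).inter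
    (measurableSet_lt (by fun_prop) (by fun_prop))

theorem measurableSet_twoAbove {n : ℕ} (x : ℝ) : MeasurableSet (twoAbove (n := n) x) :=
  measurableSet_twoAbove_prod.preimage (measurable_id.prodMk measurable_const)

theorem measurableSet_exists_lt {n : ℕ} (r : ℝ) :
    MeasurableSet {v : Fin n → ℝ | ∃ i, r < v i} := by
  have : {v : Fin n → ℝ | ∃ i, r < v i} = ⋃ i, {v | r < v i} := by ext; simp
  rw [this]
  exact MeasurableSet.iUnion fun i => measurableSet_lt (by fun_prop) (by fun_prop)

theorem pi_real_exists_lt {n : ℕ} (F : Measure ℝ) [IsProbabilityMeasure F] (r : ℝ) :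
    (Measure.pi fun _ : Fin n => F).real {v | ∃ i, r < v i} = 1 - cdf F r ^ n := by
  have h : {v : Fin n → ℝ | ∃ i, r < v i}ᶜ = Set.pi univ fun _ => Iic r := by
    ext v; simp only [mem_compl_iff, mem_ofPred_eq, not_exists, not_lt, Set.mem_pi, mem_univ,
      true_implies, mem_Iic]
  have := probReal_compl_eq_one_sub (μ := Measure.pi fun _ : Fin n => F)
    (measurableSet_exists_lt (n := n) r)
  rw [h] at this
  have h2 : (Measure.pi fun _ : Fin n => F).real (Set.pi univ fun _ => Iic r) = cdf F r ^ n := by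
    rw [Measure.real, Measure.pi_pi]
    simp [cdf_eq_real, Measure.real]
  rw [h2] at this
  linarith

/-- The complement splits disjointly into "no coordinate exceeds `x`" and, for each `i`, "only
coordinate `i` does"; all these events are boxes. -/
theorem pi_real_twoAbove {k : ℕ} (F : Measure ℝ) [IsProbabilityMeasure F] (x : ℝ) :
    (Measure.pi fun _ : Fin (k + 1) => F).real (twoAbove x) = secondTail k (cdf F x) := by
  classical
  set P := Measure.pi fun _ : Fin (k + 1) => F with hP
  have hT : ∀ i : Fin (k + 1), MeasurableSet
      (Set.pi univ (Function.update (fun _ => Iic x) i (Ioi x)) : Set (Fin (k + 1) → ℝ)) := by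
    intro i
    refine MeasurableSet.univ_pi fun j => ?_
    by_cases h : j = i
    · subst h; simp [measurableSet_Ioi]
    · simp [h, measurableSet_Iic]
  have hmem : ∀ (i : Fin (k + 1)) (v : Fin (k + 1) → ℝ),
      v ∈ Set.pi univ (Function.update (fun _ => Iic x) i (Ioi x)) ↔
        x < v i ∧ ∀ j, j ≠ i → v j ≤ x := by
    intro i v
    simp only [Set.mem_pi, mem_univ, true_implies]
    constructor
    · intro h
      refine ⟨by simpa using h i, fun j hj => by simpa [hj] using h j⟩
    · rintro ⟨h1, h2⟩ j
      by_cases h : j = i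
      · subst h; simpa using h1
      · simpa [h] using h2 j h
  have hc : (twoAbove x)ᶜ = (Set.pi univ fun _ : Fin (k + 1) => Iic x) ∪
      ⋃ i, Set.pi univ (Function.update (fun _ => Iic x) i (Ioi x)) := by
    ext v
    simp only [mem_compl_iff, mem_union, mem_iUnion, hmem]
    constructor
    · intro h
      by_cases h0 : ∃ i, x < v i
      · obtain ⟨i, hi⟩ := h0
        refine Or.inr ⟨i, hi, fun j hj => ?_⟩
        by_contra hj'
        exact h ⟨j, i, hj, not_le.1 hj', hi⟩
      · push Not at h0
        exact Or.inl fun i _ => h0 i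
    · rintro (h | ⟨i, hi, h⟩) ⟨j, l, hjl, hj, hl⟩
      · exact absurd (h j (mem_univ _)) (not_le.2 hj)
      · by_cases hji : j = i
        · exact absurd (h l fun e => hjl (hji.trans e.symm)) (not_le.2 hl)
        · exact absurd (h j hji) (not_le.2 hj)
  have hy : F.real (Iic x) = cdf F x := (cdf_eq_real F x).symm
  have hy' : F.real (Ioi x) = 1 - cdf F x := by
    rw [← compl_Iic, probReal_compl_eq_one_sub measurableSet_Iic, hy]
  have h1 : P.real (Set.pi univ fun _ : Fin (k + 1) => Iic x) = cdf F x ^ (k + 1) := by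
    rw [Measure.real, hP, Measure.pi_pi]
    simp [cdf_eq_real, Measure.real]
  have h2 : ∀ i : Fin (k + 1),
      P.real (Set.pi univ (Function.update (fun _ => Iic x) i (Ioi x))) =
        (1 - cdf F x) * cdf F x ^ k := by
    intro i
    rw [Measure.real, hP, Measure.pi_pi, ENNReal.toReal_prod,
      ← Finset.mul_prod_erase _ _ (Finset.mem_univ i)]
    have : ∀ j ∈ Finset.univ.erase i,
        (F (Function.update (fun _ => Iic x) i (Ioi x) j)).toReal = cdf F x := by
      intro j hj
      rw [Function.update_of_ne (Finset.ne_of_mem_erase hj), ← hy]; rfl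
    rw [Finset.prod_congr rfl this, Finset.prod_const, Finset.card_erase_of_mem (Finset.mem_univ i),
      Function.update_self, ← hy']
    simp [Measure.real]
  have h3 : P.real (⋃ i, Set.pi univ (Function.update (fun _ => Iic x) i (Ioi x))) =
      (k + 1) * ((1 - cdf F x) * cdf F x ^ k) := by
    rw [measureReal_iUnion_fintype _ hT]
    · simp [h2]
    · intro i j hij
      rw [Function.onFun, Set.disjoint_left]
      intro v hv hv'
      rw [hmem] at hv hv'
      exact absurd (hv'.2 i hij) (not_le.2 hv.1)
  have h4 : P.real (twoAbove x)ᶜ =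
      cdf F x ^ (k + 1) + (k + 1) * ((1 - cdf F x) * cdf F x ^ k) := by
    rw [hc, measureReal_union _ (MeasurableSet.iUnion hT), h1, h3]
    rw [Set.disjoint_left]
    intro v hv hv'
    obtain ⟨i, hi⟩ := mem_iUnion.1 hv'
    exact absurd (hv i (mem_univ _)) (not_le.2 ((hmem i v).1 hi).1)
  rw [probReal_compl_eq_one_sub (measurableSet_twoAbove x)] at h4
  rw [secondTail]
  linear_combination -h4

theorem ae_pi_mem_Icc {n : ℕ} {F : Measure ℝ} [IsProbabilityMeasure F] {vbar : ℝ}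
    (hF : F (Icc 0 vbar)ᶜ = 0) :
    ∀ᵐ v ∂(Measure.pi fun _ : Fin n => F), ∀ i, v i ∈ Icc 0 vbar := by
  rw [ae_all_iff]
  intro i
  exact (measurePreserving_eval (fun _ : Fin n => F) i).quasiMeasurePreserving.ae
    (p := fun x => x ∈ Icc 0 vbar) hF

/-- Expected revenue at reserve `r` in terms of the distribution function of the values. -/
theorem revenueAt_eq {k : ℕ} (hk : 1 ≤ k) {winner : (Fin (k + 1) → ℝ) → Fin (k + 1)}
    (hw : IsTieBreaking winner) {F : Measure ℝ} [IsProbabilityMeasure F] {vbar r : ℝ}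
    (hF : F (Icc 0 vbar)ᶜ = 0) (hr : r ≤ vbar) :
    revenueAt winner F r =
      r * (1 - cdf F r ^ (k + 1)) + ∫ x in r..vbar, secondTail k (cdf F x) := by
  set P := Measure.pi fun _ : Fin (k + 1) => F with hP
  have hae : ∀ᵐ v ∂P, ∑ i, payment winner r v i =
      ({v : Fin (k + 1) → ℝ | ∃ i, r < v i}.indicator (fun _ => r) v) +
        ∫ x in Ioc r vbar, (twoAbove x).indicator (fun _ => (1 : ℝ)) v := by
    filter_upwards [ae_pi_mem_Icc (n := k + 1) hF] with v hv
    exact sum_payment_eq (by omega) hw fun i => (hv i).2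
  have hI : Integrable (Function.uncurry fun (v : Fin (k + 1) → ℝ) (x : ℝ) =>
      (twoAbove x).indicator (fun _ => (1 : ℝ)) v) (P.prod (volume.restrict (Ioc r vbar))) := by
    have : (Function.uncurry fun (v : Fin (k + 1) → ℝ) (x : ℝ) =>
        (twoAbove x).indicator (fun _ => (1 : ℝ)) v) =
        {z : (Fin (k + 1) → ℝ) × ℝ | z.1 ∈ twoAbove z.2}.indicator fun _ => 1 := by
      classical
      ext ⟨v, x⟩
      simp only [indicator_apply, Function.uncurry, mem_ofPred_eq]
    rw [this]
    exact (integrable_const _).indicator measurableSet_twoAbove_prod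
  rw [revenueAt, integral_congr_ae hae, integral_add]
  · rw [integral_indicator (measurableSet_exists_lt r), setIntegral_const, pi_real_exists_lt,
      integral_integral_swap hI, intervalIntegral.integral_of_le hr, smul_eq_mul, mul_comm]
    congr 1
    refine integral_congr_ae (Filter.Eventually.of_forall fun x => ?_)
    simp only
    rw [integral_indicator (measurableSet_twoAbove x), setIntegral_const, smul_eq_mul, mul_one,
      pi_real_twoAbove]
  · exact (integrable_const _).indicator (measurableSet_exists_lt r)
  · exact hI.integral_prod_left

end RobustAuction

/-! ### Revenue bounds, and from saddle points to max-min strategies -/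

namespace RobustAuction

theorem sum_payment_nonneg {n : ℕ} (winner : (Fin n → ℝ) → Fin n) {r : ℝ} (hr : 0 ≤ r)
    (b : Fin n → ℝ) : 0 ≤ ∑ i, payment winner r b i := by
  rw [sum_payment]
  split_ifs
  · exact le_max_of_le_left hr
  · exact le_rfl

theorem sum_payment_le {n : ℕ} (hn : 2 ≤ n) {winner : (Fin n → ℝ) → Fin n}
    (hw : IsTieBreaking winner) {r vbar : ℝ} (hv : 0 ≤ vbar) (hr : r ≤ vbar) {b : Fin n → ℝ}
    (hb : ∀ i, b i ≤ vbar) : ∑ i, payment winner r b i ≤ vbar := by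
  rw [sum_payment]
  split_ifs
  · exact max_le hr ((iSup_ne_winner_le hn hw b).trans (hb _))
  · exact hv

/-- The bound needs no integrability, since the integral of a nonintegrable function is `0`. -/
theorem integral_le_of_ae_le_const {α : Type*} [MeasurableSpace α] {μ : Measure α}
    [IsProbabilityMeasure μ] {f : α → ℝ} {C : ℝ} (hC : 0 ≤ C) (h : ∀ᵐ x ∂μ, f x ≤ C) :
    ∫ x, f x ∂μ ≤ C := by
  by_cases hf : Integrable f μ
  · simpa using integral_mono_ae hf (integrable_const C) h
  · rwa [integral_undef hf]

theorem Reserves.ae_mem {vbar : ℝ} {Q : Measure ℝ} (hQ : Q ∈ Reserves vbar) :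
    ∀ᵐ r ∂Q, r ∈ Icc 0 vbar := hQ.2

theorem revenue_le_of_forall_revenueAt_le {n : ℕ} {winner : (Fin n → ℝ) → Fin n}
    {F Q : Measure ℝ} {vbar C : ℝ} (hC : 0 ≤ C) (hQ : Q ∈ Reserves vbar)
    (h : ∀ r ∈ Icc 0 vbar, revenueAt winner F r ≤ C) : revenue winner F Q ≤ C := by
  have := hQ.1
  exact integral_le_of_ae_le_const hC ((Reserves.ae_mem hQ).mono h)

theorem revenueAt_nonneg {n : ℕ} (winner : (Fin n → ℝ) → Fin n) (F : Measure ℝ) {r : ℝ}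
    (hr : 0 ≤ r) : 0 ≤ revenueAt winner F r :=
  integral_nonneg fun b => sum_payment_nonneg winner hr b

theorem revenue_nonneg {n : ℕ} (winner : (Fin n → ℝ) → Fin n) (F : Measure ℝ) {vbar : ℝ}
    {Q : Measure ℝ} (hQ : Q ∈ Reserves vbar) : 0 ≤ revenue winner F Q :=
  integral_nonneg_of_ae <| (Reserves.ae_mem hQ).mono fun _ hr => revenueAt_nonneg winner F hr.1

/-- With `revenue_nonneg` this supplies the boundedness required by the real-valued `⨆` and `⨅` in
`exposure` and `guarantee`. -/
theorem revenue_le {n : ℕ} (hn : 2 ≤ n) {winner : (Fin n → ℝ) → Fin n}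
    (hw : IsTieBreaking winner) {m vbar : ℝ} (hv : 0 ≤ vbar) {F Q : Measure ℝ}
    (hF : F ∈ Compatible m vbar) (hQ : Q ∈ Reserves vbar) : revenue winner F Q ≤ vbar := by
  have := hF.1
  refine revenue_le_of_forall_revenueAt_le hv hQ fun r hr => integral_le_of_ae_le_const hv ?_
  filter_upwards [ae_pi_mem_Icc (n := n) hF.2.1] with b hb
  exact sum_payment_le hn hw hv hr.2 fun i => (hb i).2

/-- A saddle point consists of a max-min and a min-max strategy. -/
theorem IsEquilibrium.solvesReducedProblem {n : ℕ} (hn : 2 ≤ n) {winner : (Fin n → ℝ) → Fin n}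
    (hw : IsTieBreaking winner) {m vbar : ℝ} (hv : 0 ≤ vbar) {Q F : Measure ℝ}
    (h : IsEquilibrium winner m vbar Q F) : SolvesReducedProblem winner m vbar Q F where
  seller_mem := h.seller_mem
  adversary_mem := h.adversary_mem
  seller_maxmin Q' hQ' := by
    have : Nonempty (Compatible m vbar) := ⟨⟨F, h.adversary_mem⟩⟩
    calc guarantee winner m vbar Q' ≤ revenue winner F Q' :=
          ciInf_le ⟨0, by rintro _ ⟨F', rfl⟩; exact revenue_nonneg winner F' hQ'⟩
            (⟨F, h.adversary_mem⟩ : Compatible m vbar)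
      _ ≤ revenue winner F Q := h.seller_best Q' hQ'
      _ ≤ guarantee winner m vbar Q := le_ciInf fun F' => h.adversary_best F' F'.2
  adversary_minmax F' hF' := by
    have : Nonempty (Reserves vbar) := ⟨⟨Q, h.seller_mem⟩⟩
    calc exposure winner vbar F ≤ revenue winner F Q :=
          ciSup_le fun Q' => h.seller_best Q' Q'.2
      _ ≤ revenue winner F' Q := h.adversary_best F' hF'
      _ ≤ exposure winner vbar F' :=
          le_ciSup (f := fun Q' : Reserves vbar => revenue winner F' Q')
            ⟨vbar, by rintro _ ⟨Q', rfl⟩; exact revenue_le hn hw hv hF' Q'.2⟩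
            (⟨Q, h.seller_mem⟩ : Reserves vbar)

/-! ### Revenue with a random reserve, and the mean -/

theorem measurable_cdf (F : Measure ℝ) : Measurable (cdf F) := (monotone_cdf F).measurable

theorem continuous_secondTail (k : ℕ) : Continuous (secondTail k) := by
  unfold secondTail; fun_prop

/-- Continuous functions of a distribution function are bounded and measurable. -/
theorem exists_bound_comp_cdf {g : ℝ → ℝ} (hg : Continuous g) (F : Measure ℝ) :
    ∃ C, ∀ x, ‖g (cdf F x)‖ ≤ C := by
  obtain ⟨C, hC⟩ := isCompact_Icc.exists_bound_of_continuousOn (s := Icc (0 : ℝ) 1)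
    hg.continuousOn
  exact ⟨C, fun x => hC _ ⟨cdf_nonneg F x, cdf_le_one F x⟩⟩

theorem integrable_comp_cdf {g : ℝ → ℝ} (hg : Continuous g) (F μ : Measure ℝ)
    [IsFiniteMeasure μ] : Integrable (fun x => g (cdf F x)) μ := by
  obtain ⟨C, hC⟩ := exists_bound_comp_cdf hg F
  exact Integrable.of_bound (hg.measurable.comp (measurable_cdf F)).aestronglyMeasurable C
    (Filter.Eventually.of_forall hC)

theorem intervalIntegrable_comp_cdf {g : ℝ → ℝ} (hg : Continuous g) (F : Measure ℝ) (a b : ℝ) :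
    IntervalIntegrable (fun x => g (cdf F x)) volume a b :=
  ⟨integrable_comp_cdf hg F _, integrable_comp_cdf hg F _⟩

/-- Expected revenue with a random reserve, after exchanging the order of integration. -/
theorem revenue_eq {k : ℕ} (hk : 1 ≤ k) {winner : (Fin (k + 1) → ℝ) → Fin (k + 1)}
    (hw : IsTieBreaking winner) {F Q : Measure ℝ} [IsProbabilityMeasure F] {vbar : ℝ}
    (hv : 0 ≤ vbar) (hF : F (Icc 0 vbar)ᶜ = 0) (hQ : Q ∈ Reserves vbar) :
    revenue winner F Q = (∫ r, r * (1 - cdf F r ^ (k + 1)) ∂Q) +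
      ∫ x in 0..vbar, cdf Q x * secondTail k (cdf F x) := by
  have := hQ.1
  set H : ℝ → ℝ := fun x => secondTail k (cdf F x) with hH
  have hHm : Measurable H := (continuous_secondTail k).measurable.comp (measurable_cdf F)
  -- The domain of integration is made independent of `r`, which now enters only through an
  -- indicator; integrated over `r` first, that indicator becomes `cdf Q x`.
  have hae : ∀ᵐ r ∂Q, revenueAt winner F r = r * (1 - cdf F r ^ (k + 1)) +
      ∫ x in Ioc 0 vbar, (Ici r).indicator H x := by
    filter_upwards [Reserves.ae_mem hQ] with r hr
    rw [revenueAt_eq hk hw hF hr.2, intervalIntegral.integral_of_le hr.2,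
      integral_indicator measurableSet_Ici, Measure.restrict_restrict measurableSet_Ici]
    congr 1
    refine setIntegral_congr_set ?_
    have h0 : ∀ᵐ x : ℝ, x ≠ r := Measure.ae_ne volume r
    filter_upwards [h0] with x hx
    refine propext ⟨fun h => ⟨h.1.le, hr.1.trans_lt h.1, h.2⟩, fun h => ⟨?_, h.2.2⟩⟩
    exact lt_of_le_of_ne h.1 hx.symm
  have hI : Integrable (Function.uncurry fun (r x : ℝ) => (Ici r).indicator H x)
      (Q.prod (volume.restrict (Ioc 0 vbar))) := by
    have : (Function.uncurry fun (r x : ℝ) => (Ici r).indicator H x) =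
        {z : ℝ × ℝ | z.1 ≤ z.2}.indicator fun z => H z.2 := by
      classical
      ext ⟨r, x⟩
      simp only [indicator_apply, Function.uncurry, mem_ofPred_eq, mem_Ici]
    rw [this]
    refine Integrable.indicator ?_ (measurableSet_le measurable_fst measurable_snd)
    obtain ⟨C, hC⟩ := exists_bound_comp_cdf (continuous_secondTail k) F
    exact Integrable.of_bound (hHm.comp measurable_snd).aestronglyMeasurable C
      (Filter.Eventually.of_forall fun z => hC z.2)
  have hI1 : Integrable (fun r => r * (1 - cdf F r ^ (k + 1))) Q := by
    obtain ⟨C, hC⟩ := exists_bound_comp_cdf (g := fun y => 1 - y ^ (k + 1)) (by fun_prop) F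
    refine Integrable.of_bound (C := vbar * C) ?_ ?_
    · exact (measurable_id.mul
        (measurable_const.sub ((measurable_cdf F).pow_const _))).aestronglyMeasurable
    · filter_upwards [Reserves.ae_mem hQ] with r hr
      rw [norm_mul]
      refine mul_le_mul ?_ (hC r) (norm_nonneg _) hv
      rw [Real.norm_of_nonneg hr.1]
      exact hr.2
  have hI2 : Integrable (fun r => ∫ x in Ioc 0 vbar, (Ici r).indicator H x) Q :=
    hI.integral_prod_left
  rw [revenue, integral_congr_ae hae, integral_add hI1 hI2,
    integral_integral_swap hI, intervalIntegral.integral_of_le hv]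
  congr 1
  refine integral_congr_ae (Filter.Eventually.of_forall fun x => ?_)
  have : ∀ r, (Ici r).indicator H x = (Iic x).indicator (fun _ => H x) r := by
    classical
    intro r
    simp only [indicator_apply, mem_Ici, mem_Iic]
  simp only [this]
  rw [integral_indicator measurableSet_Iic, setIntegral_const, smul_eq_mul, cdf_eq_real]

theorem cdf_eq_one_of_le {F : Measure ℝ} [IsProbabilityMeasure F] {vbar x : ℝ}
    (hF : F (Icc 0 vbar)ᶜ = 0) (hx : vbar ≤ x) : cdf F x = 1 := by
  have h : F (Icc 0 vbar) = 1 := (prob_compl_eq_zero_iff measurableSet_Icc).1 hF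
  refine le_antisymm (cdf_le_one F x) ?_
  rw [cdf_eq_real]
  calc (1 : ℝ) = F.real (Icc 0 vbar) := by simp [Measure.real, h]
    _ ≤ F.real (Iic x) := measureReal_mono fun y hy => hy.2.trans hx

/-- The mean is the integral of the survival function. -/
theorem integral_eq_integral_one_sub_cdf {F : Measure ℝ} [IsProbabilityMeasure F] {vbar : ℝ}
    (hv : 0 ≤ vbar) (hF : F (Icc 0 vbar)ᶜ = 0) :
    ∫ v, v ∂F = ∫ x in 0..vbar, (1 - cdf F x) := by
  have hmem : ∀ᵐ v ∂F, v ∈ Icc 0 vbar := hF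
  have hint : Integrable (fun v : ℝ => v) F := by
    refine Integrable.of_bound measurable_id.aestronglyMeasurable vbar ?_
    filter_upwards [hmem] with v hv'
    rw [Real.norm_of_nonneg hv'.1]; exact hv'.2
  rw [hint.integral_eq_integral_meas_lt (hmem.mono fun v hv' => hv'.1),
    intervalIntegral.integral_of_le hv]
  have hcdf : ∀ x, F.real {a | x < a} = 1 - cdf F x := by
    intro x
    rw [cdf_eq_real, ← probReal_compl_eq_one_sub measurableSet_Iic, compl_Iic]; rfl
  simp_rw [hcdf]
  refine (setIntegral_eq_of_subset_of_forall_sdiff_eq_zero measurableSet_Ioi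
    (fun x hx => hx.1) ?_)
  rintro x ⟨hx0, hx⟩
  rw [cdf_eq_one_of_le hF, sub_self]
  by_contra h
  exact hx ⟨hx0, (not_le.1 h).le⟩

/-! ### Measures given by a density on an interval -/

/-- The measure on `(w, b]` with density `g`. -/
noncomputable def densityOn (w b : ℝ) (g : ℝ → ℝ) : Measure ℝ :=
  (volume.restrict (Ioc w b)).withDensity fun x => ENNReal.ofReal (g x)

/-- The fundamental theorem of calculus; clamping `x` to `[w, b]` covers the three positions of `x`
in one formula. -/
theorem densityOn_Iic {w b : ℝ} {g S : ℝ → ℝ} (hwb : w ≤ b)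
    (hS : ∀ x ∈ Icc w b, HasDerivAt S (g x) x) (hg : ContinuousOn g (Icc w b))
    (hg0 : ∀ x ∈ Icc w b, 0 ≤ g x) (x : ℝ) :
    densityOn w b g (Iic x) = ENNReal.ofReal (S (max w (min x b)) - S w) := by
  rw [densityOn, withDensity_apply _ measurableSet_Iic, Measure.restrict_restrict measurableSet_Iic]
  rcases le_or_gt x w with hx | hx
  · have : Iic x ∩ Ioc w b = ∅ := by
      ext y
      simp only [mem_inter_iff, mem_Iic, mem_Ioc, mem_empty_iff_false, iff_false]
      rintro ⟨h1, h2, -⟩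
      linarith
    rw [this, max_eq_left ((min_le_left _ _).trans hx)]
    simp
  · have hwx : w ≤ min x b := le_min hx.le hwb
    have : Iic x ∩ Ioc w b = Ioc w (min x b) := by
      ext y
      simp only [mem_inter_iff, mem_Iic, mem_Ioc, le_min_iff]
      tauto
    have hsub : Icc w (min x b) ⊆ Icc w b := Icc_subset_Icc_right (min_le_right _ _)
    rw [this, max_eq_right hwx, ← ofReal_integral_eq_lintegral_ofReal,
      ← intervalIntegral.integral_of_le hwx,
      intervalIntegral.integral_eq_sub_of_hasDerivAt (f := S)]
    · intro y hy
      rw [uIcc_of_le hwx] at hy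
      exact hS y (hsub hy)
    · exact (hg.mono hsub).intervalIntegrable_of_Icc hwx
    · exact ((hg.mono hsub).integrableOn_Icc).mono_set Ioc_subset_Icc_self
    · filter_upwards [ae_restrict_mem measurableSet_Ioc] with y hy
      exact hg0 y (hsub (Ioc_subset_Icc_self hy))

theorem integral_densityOn {w b : ℝ} {g : ℝ → ℝ} (hwb : w ≤ b) (hg : ContinuousOn g (Icc w b))
    (hg0 : ∀ x ∈ Icc w b, 0 ≤ g x) (f : ℝ → ℝ) :
    ∫ x, f x ∂densityOn w b g = ∫ x in w..b, g x * f x := by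
  rw [densityOn, integral_withDensity_eq_integral_toReal_smul₀,
    intervalIntegral.integral_of_le hwb]
  · refine setIntegral_congr_fun measurableSet_Ioc fun x hx => ?_
    simp only [ENNReal.toReal_ofReal (hg0 x (Ioc_subset_Icc_self hx)), smul_eq_mul]
  · exact ((hg.mono Ioc_subset_Icc_self).aemeasurable measurableSet_Ioc).ennreal_ofReal
  · simp

theorem integrable_densityOn {w b : ℝ} {g : ℝ → ℝ} (hg : ContinuousOn g (Icc w b))
    (hg0 : ∀ x ∈ Icc w b, 0 ≤ g x) {f : ℝ → ℝ}
    (hf : IntegrableOn (fun x => g x * f x) (Ioc w b)) : Integrable f (densityOn w b g) := by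
  rw [densityOn, integrable_withDensity_iff_integrable_smul₀']
  · refine hf.congr_fun (fun x hx => ?_) measurableSet_Ioc
    simp only [ENNReal.toReal_ofReal (hg0 x (Ioc_subset_Icc_self hx)), smul_eq_mul]
  · exact ((hg.mono Ioc_subset_Icc_self).aemeasurable measurableSet_Ioc).ennreal_ofReal
  · simp

theorem densityOn_ae_mem {w b : ℝ} {g : ℝ → ℝ} : ∀ᵐ x ∂densityOn w b g, x ∈ Ioc w b :=
  (withDensity_absolutelyContinuous _ _).ae_le (ae_restrict_mem measurableSet_Ioc)

end RobustAuction

/-! ### The adversary's distribution -/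

namespace RobustAuction

/-- Consecutive indices differ by a multiple of a square. No bound `t ≤ 1` is imposed because the
Lagrangian argument evaluates at `y / u`, which may exceed `1`. -/
theorem secondTail_nonneg (k : ℕ) {t : ℝ} (ht : 0 ≤ t) : 0 ≤ secondTail k t := by
  induction k with
  | zero => simp [secondTail]
  | succ j ih =>
    have h : secondTail (j + 1) t = secondTail j t + (j + 1) * t ^ j * (t - 1) ^ 2 := by
      simp only [secondTail]; push_cast; ring
    rw [h]
    positivity

theorem densityOn_univ {w b : ℝ} {g S : ℝ → ℝ} (hwb : w ≤ b)
    (hS : ∀ x ∈ Icc w b, HasDerivAt S (g x) x) (hg : ContinuousOn g (Icc w b))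
    (hg0 : ∀ x ∈ Icc w b, 0 ≤ g x) :
    densityOn w b g univ = ENNReal.ofReal (S b - S w) := by
  have h := densityOn_Iic hwb hS hg hg0 b
  rw [min_self, max_eq_right hwb] at h
  rw [← h]
  refine measure_congr ?_
  filter_upwards [densityOn_ae_mem (w := w) (b := b) (g := g)] with x hx
  exact propext ⟨fun _ => hx.2, fun _ => trivial⟩

/-- The adversary's distribution: an atom at `v₀`, an equal-revenue part on `(w, b]` and an atom
at `b`. -/
noncomputable def adversaryMeasure (k : ℕ) (v₀ w b : ℝ) : Measure ℝ :=
  ENNReal.ofReal (1 - 1 / (k : ℝ) ^ 2) • Measure.dirac v₀ +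
    densityOn w b (fun x => w / (k : ℝ) ^ 2 / x ^ 2) +
    ENNReal.ofReal (w / (k : ℝ) ^ 2 / b) • Measure.dirac b

section Adversary

theorem hasDerivAt_neg_div (a : ℝ) {x : ℝ} (hx : x ≠ 0) :
    HasDerivAt (fun x => -(a / x)) (a / x ^ 2) x := by
  have h := ((hasDerivAt_inv hx).const_mul a).neg
  refine (h.congr_deriv ?_).congr_of_eventuallyEq ?_
  · field_simp
  · exact Filter.Eventually.of_forall fun y => by simp [div_eq_mul_inv]

theorem continuousOn_equalRevenueDensity (a : ℝ) {w b : ℝ} (hw : 0 < w) :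
    ContinuousOn (fun x : ℝ => a / x ^ 2) (Icc w b) := by
  refine continuousOn_const.div (by fun_prop) fun x hx => ?_
  have : 0 < x := hw.trans_le hx.1
  positivity

variable {k : ℕ} {v₀ w b : ℝ}

theorem one_sub_inv_sq_nonneg (hk : 1 ≤ k) : 0 ≤ 1 - 1 / (k : ℝ) ^ 2 := by
  have : (1 : ℝ) ≤ k := by exact_mod_cast hk
  rw [sub_nonneg, div_le_one (by positivity)]
  nlinarith

theorem adversaryMeasure_Iic (hk : 1 ≤ k) (hw : 0 < w) (hwb : w ≤ b) (x : ℝ) :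
    (adversaryMeasure k v₀ w b).real (Iic x) =
      (if v₀ ≤ x then 1 - 1 / (k : ℝ) ^ 2 else 0) +
      (1 / (k : ℝ) ^ 2 - w / (k : ℝ) ^ 2 / max w (min x b)) +
      (if b ≤ x then w / (k : ℝ) ^ 2 / b else 0) := by
  classical
  have hk0 : (0 : ℝ) < k := by exact_mod_cast hk
  have hb : 0 < b := hw.trans_le hwb
  have hp := one_sub_inv_sq_nonneg hk
  have hd := densityOn_Iic hwb (g := fun x => w / (k : ℝ) ^ 2 / x ^ 2)
    (S := fun x => -(w / (k : ℝ) ^ 2 / x))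
    (fun x hx => hasDerivAt_neg_div _ (hw.trans_le hx.1).ne')
    (continuousOn_equalRevenueDensity _ hw) (fun x _ => by positivity) x
  have hM : w ≤ max w (min x b) := le_max_left _ _
  have hM0 : 0 < max w (min x b) := hw.trans_le hM
  have hle : w / (k : ℝ) ^ 2 / max w (min x b) ≤ w / (k : ℝ) ^ 2 / w :=
    div_le_div_of_nonneg_left (by positivity) hw hM
  have hww : w / (k : ℝ) ^ 2 / w = 1 / (k : ℝ) ^ 2 := by field_simp
  rw [hww] at hle
  simp only [Measure.real, adversaryMeasure, Measure.add_apply, Measure.smul_apply, hd,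
    Measure.dirac_apply' _ measurableSet_Iic, smul_eq_mul, indicator_apply, mem_Iic,
    Pi.one_apply, hww]
  rw [ENNReal.toReal_add (by split_ifs <;> simp) (by split_ifs <;> simp),
    ENNReal.toReal_add (by split_ifs <;> simp) (by simp),
    ENNReal.toReal_ofReal (by linarith)]
  congr 1
  · congr 1
    · split_ifs
      · rw [mul_one, ENNReal.toReal_ofReal hp]
      · simp
    · ring
  · split_ifs
    · rw [mul_one, ENNReal.toReal_ofReal (by positivity)]
    · simp

theorem isProbabilityMeasure_adversaryMeasure (hk : 1 ≤ k) (hw : 0 < w) (hwb : w ≤ b) :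
    IsProbabilityMeasure (adversaryMeasure k v₀ w b) := by
  have hk0 : (0 : ℝ) < k := by exact_mod_cast hk
  have hb : 0 < b := hw.trans_le hwb
  have hp := one_sub_inv_sq_nonneg hk
  have hd := densityOn_univ hwb (g := fun x => w / (k : ℝ) ^ 2 / x ^ 2)
    (S := fun x => -(w / (k : ℝ) ^ 2 / x))
    (fun x hx => hasDerivAt_neg_div _ (hw.trans_le hx.1).ne')
    (continuousOn_equalRevenueDensity _ hw) (fun x _ => by positivity)
  have hle : w / (k : ℝ) ^ 2 / b ≤ w / (k : ℝ) ^ 2 / w :=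
    div_le_div_of_nonneg_left (by positivity) hw hwb
  have hww : w / (k : ℝ) ^ 2 / w = 1 / (k : ℝ) ^ 2 := by field_simp
  rw [hww] at hle
  refine ⟨?_⟩
  simp only [adversaryMeasure, Measure.add_apply, Measure.smul_apply, hd, measure_univ, smul_eq_mul,
    mul_one, hww]
  rw [← ENNReal.ofReal_add hp (by linarith), ← ENNReal.ofReal_add (by linarith) (by positivity),
    ← ENNReal.ofReal_one]
  congr 1
  ring

theorem cdf_adversaryMeasure (hk : 1 ≤ k) (hw : 0 < w) (hwb : w ≤ b) (hvw : v₀ ≤ w) (x : ℝ) :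
    cdf (adversaryMeasure k v₀ w b) x =
      if x < v₀ then 0 else if x < w then 1 - 1 / (k : ℝ) ^ 2
      else if x < b then 1 - w / (k : ℝ) ^ 2 / x else 1 := by
  have := isProbabilityMeasure_adversaryMeasure (v₀ := v₀) hk hw hwb
  have hk0 : (0 : ℝ) < k := by exact_mod_cast hk
  have hww : w / (k : ℝ) ^ 2 / w = 1 / (k : ℝ) ^ 2 := by field_simp
  rw [cdf_eq_real, adversaryMeasure_Iic hk hw hwb]
  split_ifs <;> try linarith
  · rw [min_eq_right (by linarith), max_eq_right hwb]; ring
  · rw [max_eq_left ((min_le_left _ _).trans (by linarith)), hww]; ring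
  · rw [min_eq_left (by linarith), max_eq_right (by linarith)]; ring
  · rw [max_eq_left ((min_le_left _ _).trans (by linarith)), hww]; ring

theorem adversaryMeasure_compl (hv : 0 ≤ v₀) (hvw : v₀ ≤ w) (hw : 0 < w) (hwb : w ≤ b) :
    adversaryMeasure k v₀ w b (Icc 0 b)ᶜ = 0 := by
  have hm : MeasurableSet (Icc 0 b)ᶜ := measurableSet_Icc.compl
  have hd : densityOn w b (fun x => w / (k : ℝ) ^ 2 / x ^ 2) (Icc 0 b)ᶜ = 0 := by
    have : ∀ᵐ x ∂densityOn w b (fun x => w / (k : ℝ) ^ 2 / x ^ 2), x ∈ Icc 0 b :=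
      densityOn_ae_mem.mono fun x hx => ⟨hw.le.trans hx.1.le, hx.2⟩
    exact this
  have h1 : v₀ ∉ (Icc 0 b)ᶜ := fun h => h ⟨hv, hvw.trans hwb⟩
  have h2 : b ∉ (Icc 0 b)ᶜ := fun h => h ⟨hw.le.trans hwb, le_rfl⟩
  simp only [adversaryMeasure, Measure.add_apply, Measure.smul_apply, hd,
    Measure.dirac_apply' _ hm, indicator_of_notMem h1, indicator_of_notMem h2, smul_zero, add_zero]

/-- The density contributes the logarithm and the atom at `b` the last term. For `v₀ = w / k`,
equating this mean to `m` is the threshold equation divided by `k²`. -/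
theorem integral_adversaryMeasure (hk : 1 ≤ k) (hw : 0 < w) (hwb : w ≤ b) :
    ∫ v, v ∂adversaryMeasure k v₀ w b =
      (1 - 1 / (k : ℝ) ^ 2) * v₀ + w / (k : ℝ) ^ 2 * Real.log (b / w) + w / (k : ℝ) ^ 2 := by
  have hk0 : (0 : ℝ) < k := by exact_mod_cast hk
  have hb : 0 < b := hw.trans_le hwb
  have hp := one_sub_inv_sq_nonneg hk
  have hc := continuousOn_equalRevenueDensity (w / (k : ℝ) ^ 2) (b := b) hw
  have h0 : ∀ x ∈ Icc w b, 0 ≤ w / (k : ℝ) ^ 2 / x ^ 2 := fun x _ => by positivity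
  have hi : Integrable (fun v : ℝ => v) (densityOn w b fun x => w / (k : ℝ) ^ 2 / x ^ 2) :=
    integrable_densityOn hc h0
      (((hc.mul continuousOn_id).integrableOn_Icc).mono_set Ioc_subset_Icc_self)
  have hd : ∀ (C y : ℝ), Integrable (fun v : ℝ => v) (ENNReal.ofReal C • Measure.dirac y) :=
    fun C y => (integrable_dirac (by simp)).smul_measure (by simp)
  rw [adversaryMeasure, integral_add_measure ((hd _ _).add_measure hi) (hd _ _),
    integral_add_measure (hd _ _) hi, integral_smul_measure, integral_smul_measure, integral_dirac,
    integral_dirac, integral_densityOn hwb hc h0, ENNReal.toReal_ofReal hp,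
    ENNReal.toReal_ofReal (by positivity)]
  have : ∫ x in w..b, w / (k : ℝ) ^ 2 / x ^ 2 * x = ∫ x in w..b, w / (k : ℝ) ^ 2 * x⁻¹ := by
    refine intervalIntegral.integral_congr fun x hx => ?_
    rw [uIcc_of_le hwb] at hx
    have : 0 < x := hw.trans_le hx.1
    field_simp
  rw [this, intervalIntegral.integral_const_mul, integral_inv_of_pos hw hb, smul_eq_mul,
    smul_eq_mul]
  field_simp

end Adversary

end RobustAuction

/-! ### The seller's distribution -/

namespace RobustAuction

/-- The normalizing factor of the seller's distribution function. -/
noncomputable def sellerScale (k : ℕ) (w b : ℝ) : ℝ :=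
  (1 - w / (k : ℝ) ^ 2 / b) ^ k / ((k : ℝ) - 1 / k + Real.log (b / w))

/-- The seller's distribution function on `[w, b]`. -/
noncomputable def sellerCdf (k : ℕ) (w b r : ℝ) : ℝ :=
  sellerScale k w b / (1 - w / (k : ℝ) ^ 2 / r) ^ k * ((k : ℝ) - 1 / k + Real.log (r / w))

/-- The derivative of `sellerCdf`. -/
noncomputable def sellerDensity (k : ℕ) (w b r : ℝ) : ℝ :=
  sellerScale k w b / (1 - w / (k : ℝ) ^ 2 / r) ^ k *
    (1 - k * ((k : ℝ) - 1 / k + Real.log (r / w)) * (1 - (1 - w / (k : ℝ) ^ 2 / r)) /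
      (1 - w / (k : ℝ) ^ 2 / r)) / r

/-- The seller's distribution: an atom at `0` and a density on `(w, b]`. -/
noncomputable def sellerMeasure (k : ℕ) (w b : ℝ) : Measure ℝ :=
  ENNReal.ofReal (sellerCdf k w b w) • Measure.dirac 0 + densityOn w b (sellerDensity k w b)

variable {k : ℕ} {w b r : ℝ}

theorem one_sub_div_pos (hk : 2 ≤ k) (hw : 0 < w) (hr : w ≤ r) : 0 < 1 - w / (k : ℝ) ^ 2 / r := by
  have hk2 : (2 : ℝ) ≤ k := by exact_mod_cast hk
  have hr0 : 0 < r := hw.trans_le hr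
  have hk4 : (1 : ℝ) < (k : ℝ) ^ 2 := by nlinarith
  rw [sub_pos, div_div, div_lt_one (by positivity)]
  nlinarith

theorem coef_pos (hk : 2 ≤ k) : 0 < (k : ℝ) - 1 / k := by
  have hk2 : (2 : ℝ) ≤ k := by exact_mod_cast hk
  rw [sub_pos, div_lt_iff₀ (by linarith)]
  nlinarith

theorem coef_add_log_pos (hk : 2 ≤ k) (hw : 0 < w) (hr : w ≤ r) :
    0 < (k : ℝ) - 1 / k + Real.log (r / w) :=
  add_pos_of_pos_of_nonneg (coef_pos hk) (Real.log_nonneg ((one_le_div hw).2 hr))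

theorem sellerScale_pos (hk : 2 ≤ k) (hw : 0 < w) (hwb : w ≤ b) : 0 < sellerScale k w b :=
  div_pos (pow_pos (one_sub_div_pos hk hw hwb) _) (coef_add_log_pos hk hw hwb)

theorem sellerCdf_pos (hk : 2 ≤ k) (hw : 0 < w) (hwb : w ≤ b) (hr : w ≤ r) :
    0 < sellerCdf k w b r :=
  mul_pos (div_pos (sellerScale_pos hk hw hwb) (pow_pos (one_sub_div_pos hk hw hr) _))
    (coef_add_log_pos hk hw hr)

theorem sellerCdf_right (hk : 2 ≤ k) (hw : 0 < w) (hwb : w ≤ b) : sellerCdf k w b b = 1 := by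
  have h1 := (pow_pos (one_sub_div_pos hk hw hwb) k).ne'
  have h2 := (coef_add_log_pos hk hw hwb).ne'
  rw [sellerCdf, sellerScale, div_div, div_mul_eq_mul_div, mul_comm (_ + _)]
  exact div_self (mul_ne_zero h1 h2)

theorem hasDerivAt_sellerCdf (hk : 2 ≤ k) (hw : 0 < w) (hr : w ≤ r) :
    HasDerivAt (sellerCdf k w b) (sellerDensity k w b r) r := by
  obtain ⟨j, rfl⟩ : ∃ j, k = j + 1 := ⟨k - 1, by omega⟩
  have hr0 : 0 < r := hw.trans_le hr
  have hu := one_sub_div_pos hk hw hr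
  set a := w / ((j + 1 : ℕ) : ℝ) ^ 2 with ha
  have h1 : HasDerivAt (fun x => 1 - a / x) (a / r ^ 2) r := by
    simpa [sub_eq_add_neg] using (hasDerivAt_neg_div a hr0.ne').const_add 1
  have h2 : HasDerivAt (fun x => sellerScale (j + 1) w b / (1 - a / x) ^ (j + 1)) _ r :=
    (hasDerivAt_const r (sellerScale (j + 1) w b)).div (h1.pow (j + 1)) (pow_pos hu _).ne'
  have h3 : HasDerivAt (fun x : ℝ => ((j + 1 : ℕ) : ℝ) - 1 / (j + 1 : ℕ) + Real.log (x / w))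
      (1 / r) r := by
    have := ((hasDerivAt_id r).div_const w).log (by simp; constructor <;> positivity)
    refine (this.const_add _).congr_deriv ?_
    simp only [id]
    field_simp
  refine (h2.mul h3).congr_deriv ?_
  rw [sellerDensity, ← ha]
  generalize Real.log (r / w) = l
  generalize sellerScale (j + 1) w b = K
  -- Eliminating `a` in favour of `u` leaves a rational identity in `u`, `r`, `l` and `K`.
  have hau : a = r * (1 - (1 - a / r)) := by field_simp; ring
  set u := 1 - a / r with hu'
  rw [hau]
  simp only [Nat.add_sub_cancel]
  field_simp
  ring

/-- With `t = r / w`, the bound `log t ≤ t - 1` reduces the sign of the bracket to that of `(k -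
1)(t - 1) / (k t)`. At `r = w` the density vanishes. -/
theorem sellerDensity_nonneg (hk : 2 ≤ k) (hw : 0 < w) (hwb : w ≤ b) (hr : w ≤ r) :
    0 ≤ sellerDensity k w b r := by
  have hk2 : (2 : ℝ) ≤ k := by exact_mod_cast hk
  have hr0 : 0 < r := hw.trans_le hr
  have hu := one_sub_div_pos hk hw hr
  have hl : Real.log (r / w) ≤ r / w - 1 := Real.log_le_sub_one_of_pos (by positivity)
  have ht : 1 ≤ r / w := (one_le_div hw).2 hr
  refine div_nonneg (mul_nonneg (div_pos (sellerScale_pos hk hw hwb) (pow_pos hu _)).le ?_) hr0.le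
  rw [sub_nonneg, div_le_one hu]
  have h1 : 1 - w / (k : ℝ) ^ 2 / r = 1 - 1 / ((k : ℝ) ^ 2 * (r / w)) := by field_simp
  rw [h1]
  generalize r / w = t at *
  have ht0 : 0 < t := by linarith
  have h2 : k * ((k : ℝ) - 1 / k + Real.log t) * (1 - (1 - 1 / ((k : ℝ) ^ 2 * t))) ≤
      k * ((k : ℝ) - 1 / k + (t - 1)) * (1 - (1 - 1 / ((k : ℝ) ^ 2 * t))) := by
    have : 0 ≤ 1 - (1 - 1 / ((k : ℝ) ^ 2 * t)) := by
      rw [sub_sub_cancel]; positivity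
    gcongr
  refine h2.trans ?_
  rw [sub_sub_cancel, ← sub_nonneg]
  have : 1 - 1 / ((k : ℝ) ^ 2 * t) - k * (k - 1 / k + (t - 1)) * (1 / (k ^ 2 * t)) =
      (k - 1) * (t - 1) / (k * t) := by
    field_simp; ring
  rw [this]
  exact div_nonneg (mul_nonneg (by linarith) (by linarith)) (by positivity)

theorem continuousOn_sellerDensity (hk : 2 ≤ k) (hw : 0 < w) :
    ContinuousOn (sellerDensity k w b) (Icc w b) := by
  have hne : ∀ x ∈ Icc w b, x ≠ 0 := fun x hx => (hw.trans_le hx.1).ne'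
  have hu : ContinuousOn (fun x => 1 - w / (k : ℝ) ^ 2 / x) (Icc w b) :=
    continuousOn_const.sub (continuousOn_const.div continuousOn_id hne)
  have hu0 : ∀ x ∈ Icc w b, 1 - w / (k : ℝ) ^ 2 / x ≠ 0 :=
    fun x hx => (one_sub_div_pos hk hw hx.1).ne'
  have hl : ContinuousOn (fun x => Real.log (x / w)) (Icc w b) :=
    (continuousOn_id.div_const w).log fun x hx => (div_pos (hw.trans_le hx.1) hw).ne'
  refine ((continuousOn_const.div (hu.pow k) fun x hx => pow_ne_zero _ (hu0 x hx)).mul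
    (continuousOn_const.sub (((continuousOn_const.mul (continuousOn_const.add hl)).mul
      (continuousOn_const.sub hu)).div hu hu0))).div continuousOn_id hne

theorem sellerCdf_mono (hk : 2 ≤ k) (hw : 0 < w) (hwb : w ≤ b) (hr : w ≤ r) :
    sellerCdf k w b w ≤ sellerCdf k w b r := by
  refine monotoneOn_of_deriv_nonneg (convex_Ici w) (f := sellerCdf k w b)
    (fun x hx => (hasDerivAt_sellerCdf hk hw hx).continuousAt.continuousWithinAt)
    (fun x hx => ?_) (fun x hx => ?_) self_mem_Ici hr hr
  · exact (hasDerivAt_sellerCdf hk hw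
      (interior_subset hx)).differentiableAt.differentiableWithinAt
  · rw [(hasDerivAt_sellerCdf hk hw (interior_subset hx)).deriv]
    exact sellerDensity_nonneg hk hw hwb (interior_subset hx)

theorem isProbabilityMeasure_sellerMeasure (hk : 2 ≤ k) (hw : 0 < w) (hwb : w ≤ b) :
    IsProbabilityMeasure (sellerMeasure k w b) := by
  have hd := densityOn_univ hwb (fun x hx => hasDerivAt_sellerCdf (b := b) hk hw hx.1)
    (continuousOn_sellerDensity hk hw) (fun x hx => sellerDensity_nonneg hk hw hwb hx.1)
  refine ⟨?_⟩
  simp only [sellerMeasure, Measure.add_apply, Measure.smul_apply, hd, measure_univ, smul_eq_mul,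
    mul_one]
  rw [← ENNReal.ofReal_add (sellerCdf_pos hk hw hwb le_rfl).le
    (sub_nonneg.2 (sellerCdf_mono hk hw hwb hwb)), add_sub_cancel, sellerCdf_right hk hw hwb,
    ENNReal.ofReal_one]

theorem cdf_sellerMeasure (hk : 2 ≤ k) (hw : 0 < w) (hwb : w ≤ b) (x : ℝ) :
    cdf (sellerMeasure k w b) x =
      if x < 0 then 0 else sellerCdf k w b (max w (min x b)) := by
  classical
  have := isProbabilityMeasure_sellerMeasure hk hw hwb
  have hd := densityOn_Iic hwb (fun x hx => hasDerivAt_sellerCdf (b := b) hk hw hx.1)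
    (continuousOn_sellerDensity hk hw) (fun x hx => sellerDensity_nonneg hk hw hwb hx.1) x
  have h0 := sellerCdf_pos hk hw hwb le_rfl
  have h1 : sellerCdf k w b w ≤ sellerCdf k w b (max w (min x b)) :=
    sellerCdf_mono hk hw hwb (le_max_left _ _)
  rw [cdf_eq_real]
  simp only [Measure.real, sellerMeasure, Measure.add_apply, Measure.smul_apply, hd,
    Measure.dirac_apply' _ measurableSet_Iic, smul_eq_mul, indicator_apply, mem_Iic,
    Pi.one_apply]
  rw [ENNReal.toReal_add (by split_ifs <;> simp) (by simp),
    ENNReal.toReal_ofReal (sub_nonneg.2 h1)]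
  by_cases hx : x < 0
  · rw [if_pos hx, if_neg (not_le.2 hx),
      max_eq_left ((min_le_left _ _).trans (hx.le.trans hw.le))]
    simp
  · rw [if_neg hx, if_pos (not_lt.1 hx), mul_one, ENNReal.toReal_ofReal h0.le]
    ring

theorem sellerMeasure_mem (hk : 2 ≤ k) (hw : 0 < w) (hwb : w ≤ b) :
    sellerMeasure k w b ∈ Reserves b := by
  refine ⟨isProbabilityMeasure_sellerMeasure hk hw hwb, ?_⟩
  have hm : MeasurableSet (Icc 0 b)ᶜ := measurableSet_Icc.compl
  have hd : densityOn w b (sellerDensity k w b) (Icc 0 b)ᶜ = 0 := by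
    have : ∀ᵐ x ∂densityOn w b (sellerDensity k w b), x ∈ Icc 0 b :=
      densityOn_ae_mem.mono fun x hx => ⟨hw.le.trans hx.1.le, hx.2⟩
    exact this
  have h1 : (0 : ℝ) ∉ (Icc 0 b)ᶜ := fun h => h ⟨le_rfl, hw.le.trans hwb⟩
  simp only [sellerMeasure, Measure.add_apply, Measure.smul_apply, hd,
    Measure.dirac_apply' _ hm, indicator_of_notMem h1, smul_zero, add_zero]

/-- Deviation of the adversary's pointwise Lagrangian from its value at `u`. -/
theorem lagrangian_sub (hk : 1 ≤ k) {u : ℝ} (hu : u ≠ 0) (K C y : ℝ) :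
    (K / u ^ k * (1 - k * C * (1 - u) / u) * (1 - y ^ (k + 1)) +
        K / u ^ k * C * secondTail k y + (k + 1) * K * y) -
      (K / u ^ k * (1 - k * C * (1 - u) / u) * (1 - u ^ (k + 1)) +
        K / u ^ k * C * secondTail k u + (k + 1) * K * u) =
      K * ((k + 1) * y * secondTail (k - 1) (y / u) + (C - k * u) * secondTail k (y / u)) := by
  obtain ⟨j, rfl⟩ : ∃ j, k = j + 1 := ⟨k - 1, by omega⟩
  obtain ⟨t, rfl⟩ : ∃ t, y = t * u := ⟨y / u, by field_simp⟩
  rw [mul_div_cancel_right₀ _ hu]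
  simp only [secondTail, Nat.add_sub_cancel, mul_pow]
  push_cast
  field_simp
  ring

end RobustAuction

/-! ### The adversary's best response by a pointwise Lagrangian -/

namespace RobustAuction

variable {k : ℕ} {v₀ w b r : ℝ}

/-- This is the sign of the coefficient `C - k u` in `lagrangian_sub`. With `t = r / w`, the left
side is `k - 1/k + (1 - 1/t)/k`, and `1 - 1/t ≤ log t`. -/
theorem mul_le_coef_add_log (hk : 2 ≤ k) (hw : 0 < w) (hr : w ≤ r) :
    k * (1 - w / (k : ℝ) ^ 2 / r) ≤ (k : ℝ) - 1 / k + Real.log (r / w) := by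
  have hk2 : (2 : ℝ) ≤ k := by exact_mod_cast hk
  have hr0 : 0 < r := hw.trans_le hr
  have hl := Real.one_sub_inv_le_log_of_pos (show 0 < r / w by positivity)
  have h1 : 0 ≤ 1 - (r / w)⁻¹ := by
    rw [inv_div, sub_nonneg, div_le_one hr0]; exact hr
  have h2 : (1 - (r / w)⁻¹) / k ≤ 1 - (r / w)⁻¹ := div_le_self h1 (by linarith)
  have h3 : k * (1 - w / (k : ℝ) ^ 2 / r) = k - 1 / k + (1 - (r / w)⁻¹) / k := by
    field_simp; ring
  linarith

theorem mul_sellerDensity (hr : r ≠ 0) :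
    r * sellerDensity k w b r =
      sellerScale k w b / (1 - w / (k : ℝ) ^ 2 / r) ^ k *
        (1 - k * ((k : ℝ) - 1 / k + Real.log (r / w)) * (1 - (1 - w / (k : ℝ) ^ 2 / r)) /
          (1 - w / (k : ℝ) ^ 2 / r)) := by
  rw [sellerDensity, mul_div_cancel₀ _ hr]

theorem lagrangian_le (hk : 2 ≤ k) (hw : 0 < w) (hwb : w ≤ b) (hr : w ≤ r) {y : ℝ} (hy : 0 ≤ y) :
    r * sellerDensity k w b r * (1 - (1 - w / (k : ℝ) ^ 2 / r) ^ (k + 1)) +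
        sellerCdf k w b r * secondTail k (1 - w / (k : ℝ) ^ 2 / r) +
        (k + 1) * sellerScale k w b * (1 - w / (k : ℝ) ^ 2 / r) ≤
      r * sellerDensity k w b r * (1 - y ^ (k + 1)) + sellerCdf k w b r * secondTail k y +
        (k + 1) * sellerScale k w b * y := by
  have hu := one_sub_div_pos hk hw hr
  rw [← sub_nonneg, mul_sellerDensity (hw.trans_le hr).ne', sellerCdf,
    lagrangian_sub (by omega) hu.ne']
  have hK := sellerScale_pos hk hw hwb
  have ht : 0 ≤ y / (1 - w / (k : ℝ) ^ 2 / r) := div_nonneg hy hu.le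
  have h1 := secondTail_nonneg (k - 1) ht
  have h2 := secondTail_nonneg k ht
  have h3 := sub_nonneg.2 (mul_le_coef_add_log hk hw hr)
  positivity

theorem one_sub_div_self (hw : 0 < w) : 1 - w / (k : ℝ) ^ 2 / w = 1 - 1 / (k : ℝ) ^ 2 := by
  field_simp

theorem one_sub_inv_sq_pos (hk : 2 ≤ k) : 0 < 1 - 1 / (k : ℝ) ^ 2 := by
  rw [← one_sub_div_self (w := 1) one_pos]
  exact one_sub_div_pos hk one_pos le_rfl

/-- The case `r = w` of `lagrangian_sub`: there the density term drops out and `C = k u`, so only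
the summand with the factor `y` survives. That factor makes `y = 0` a minimizer alongside `y = 1 -
1/k²`. -/
theorem atom_lagrangian_sub (hk : 2 ≤ k) (hw : 0 < w) (y : ℝ) :
    (sellerCdf k w b w * secondTail k y + (k + 1) * sellerScale k w b * y) -
      (sellerCdf k w b w * secondTail k (1 - 1 / (k : ℝ) ^ 2) +
        (k + 1) * sellerScale k w b * (1 - 1 / (k : ℝ) ^ 2)) =
      sellerScale k w b * ((k + 1) * y * secondTail (k - 1) (y / (1 - 1 / (k : ℝ) ^ 2))) := by
  have hk0 : (k : ℝ) ≠ 0 := by positivity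
  have hp := one_sub_inv_sq_pos hk
  have h := lagrangian_sub (k := k) (by omega) hp.ne' (sellerScale k w b) ((k : ℝ) - 1 / k) y
  have h1 : 1 - k * ((k : ℝ) - 1 / k) * (1 - (1 - 1 / (k : ℝ) ^ 2)) / (1 - 1 / (k : ℝ) ^ 2) = 0 := by
    have : (k : ℝ) * (k - 1 / k) * (1 - (1 - 1 / (k : ℝ) ^ 2)) = 1 - 1 / (k : ℝ) ^ 2 := by
      field_simp; ring
    rw [this, div_self hp.ne', sub_self]
  have h2 : (k : ℝ) - 1 / k - k * (1 - 1 / (k : ℝ) ^ 2) = 0 := by field_simp; ring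
  rw [h1, h2] at h
  have h3 : sellerCdf k w b w =
      sellerScale k w b / (1 - 1 / (k : ℝ) ^ 2) ^ k * ((k : ℝ) - 1 / k) := by
    rw [sellerCdf, one_sub_div_self hw, div_self hw.ne', Real.log_one, add_zero]
  rw [h3]
  linear_combination h

theorem atom_lagrangian_le (hk : 2 ≤ k) (hw : 0 < w) (hwb : w ≤ b) {y : ℝ} (hy : 0 ≤ y) :
    sellerCdf k w b w * secondTail k (1 - 1 / (k : ℝ) ^ 2) +
        (k + 1) * sellerScale k w b * (1 - 1 / (k : ℝ) ^ 2) ≤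
      sellerCdf k w b w * secondTail k y + (k + 1) * sellerScale k w b * y := by
  rw [← sub_nonneg, atom_lagrangian_sub hk hw]
  have hK := sellerScale_pos hk hw hwb
  have h1 := secondTail_nonneg (k - 1) (div_nonneg hy (one_sub_inv_sq_pos hk).le)
  positivity

theorem atom_lagrangian_zero (hk : 2 ≤ k) (hw : 0 < w) :
    sellerCdf k w b w * secondTail k 0 + (k + 1) * sellerScale k w b * 0 =
      sellerCdf k w b w * secondTail k (1 - 1 / (k : ℝ) ^ 2) +
        (k + 1) * sellerScale k w b * (1 - 1 / (k : ℝ) ^ 2) := by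
  rw [← sub_eq_zero, atom_lagrangian_sub hk hw]
  simp

theorem continuousOn_sellerCdf (hk : 2 ≤ k) (hw : 0 < w) :
    ContinuousOn (sellerCdf k w b) (Icc w b) := fun _ hx =>
  (hasDerivAt_sellerCdf hk hw hx.1).continuousAt.continuousWithinAt

theorem integral_sellerMeasure_mul (hk : 2 ≤ k) (hw : 0 < w) (hwb : w ≤ b) (F : Measure ℝ) :
    ∫ r, r * (1 - cdf F r ^ (k + 1)) ∂sellerMeasure k w b =
      ∫ x in w..b, x * sellerDensity k w b x * (1 - cdf F x ^ (k + 1)) := by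
  have hc := continuousOn_sellerDensity (b := b) hk hw
  have h0 : ∀ x ∈ Icc w b, 0 ≤ sellerDensity k w b x :=
    fun x hx => sellerDensity_nonneg hk hw hwb hx.1
  have hi : Integrable (fun r : ℝ => r * (1 - cdf F r ^ (k + 1)))
      (densityOn w b (sellerDensity k w b)) := by
    refine integrable_densityOn hc h0 (IntegrableOn.mono_set ?_ Ioc_subset_Icc_self)
    have : IntegrableOn (fun x => 1 - cdf F x ^ (k + 1)) (Icc w b) :=
      integrable_comp_cdf (g := fun y => 1 - y ^ (k + 1)) (by fun_prop) F _
    simpa only [mul_assoc, Pi.mul_apply, id] using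
      this.continuousOn_mul (hc.mul continuousOn_id) isCompact_Icc
  rw [sellerMeasure, integral_add_measure
    ((integrable_dirac (by simp)).smul_measure (by simp)) hi, integral_smul_measure, integral_dirac,
    integral_densityOn hwb hc h0, zero_mul, smul_zero, zero_add]
  refine intervalIntegral.integral_congr fun x _ => ?_
  ring

/-- Revenue against the seller's distribution as an integral of a pointwise Lagrangian, whose
multiplier for the mean constraint is `(k + 1) * sellerScale k w b`. -/
theorem revenue_sellerMeasure (hk : 2 ≤ k) (hw : 0 < w) (hwb : w ≤ b)
    {winner : (Fin (k + 1) → ℝ) → Fin (k + 1)} (hwin : IsTieBreaking winner) {m : ℝ}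
    {F : Measure ℝ} (hF : F ∈ Compatible m b) :
    revenue winner F (sellerMeasure k w b) + (k + 1) * sellerScale k w b * (b - m) =
      (∫ x in 0..w, (sellerCdf k w b w * secondTail k (cdf F x) +
        (k + 1) * sellerScale k w b * cdf F x)) +
      ∫ x in w..b, (x * sellerDensity k w b x * (1 - cdf F x ^ (k + 1)) +
        sellerCdf k w b x * secondTail k (cdf F x) + (k + 1) * sellerScale k w b * cdf F x) := by
  have := hF.1
  have hb : 0 < b := hw.trans_le hwb
  set lam := (k + 1) * sellerScale k w b with hlam
  have iF : ∀ s t, IntervalIntegrable (fun x => cdf F x) volume s t :=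
    fun s t => intervalIntegrable_comp_cdf continuous_id F s t
  have iH : ∀ s t, IntervalIntegrable (fun x => secondTail k (cdf F x)) volume s t :=
    fun s t => intervalIntegrable_comp_cdf (continuous_secondTail k) F s t
  have iP : ∀ s t, IntervalIntegrable (fun x => 1 - cdf F x ^ (k + 1)) volume s t :=
    fun s t => intervalIntegrable_comp_cdf (g := fun y => 1 - y ^ (k + 1)) (by fun_prop) F s t
  have i1 : IntervalIntegrable
      (fun x => x * sellerDensity k w b x * (1 - cdf F x ^ (k + 1))) volume w b := by
    refine (iP w b).continuousOn_mul ?_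
    rw [uIcc_of_le hwb]
    exact continuousOn_id.mul (continuousOn_sellerDensity hk hw)
  have i2 : IntervalIntegrable
      (fun x => sellerCdf k w b x * secondTail k (cdf F x)) volume w b := by
    refine (iH w b).continuousOn_mul ?_
    rw [uIcc_of_le hwb]
    exact continuousOn_sellerCdf hk hw
  -- The mean constraint as a linear functional of the distribution function, ready to be weighted
  -- by the multiplier `lam`.
  have hm : m = b - ∫ x in 0..b, cdf F x := by
    rw [← hF.2.2, integral_eq_integral_one_sub_cdf hb.le hF.2.1,
      intervalIntegral.integral_sub intervalIntegrable_const (iF 0 b)]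
    simp
  have hQ : ∀ x, cdf (sellerMeasure k w b) x =
      if x < 0 then 0 else sellerCdf k w b (max w (min x b)) := cdf_sellerMeasure hk hw hwb
  have hl : ∫ x in 0..w, cdf (sellerMeasure k w b) x * secondTail k (cdf F x) =
      ∫ x in 0..w, sellerCdf k w b w * secondTail k (cdf F x) := by
    refine intervalIntegral.integral_congr fun x hx => ?_
    rw [uIcc_of_le hw.le] at hx
    rw [hQ, if_neg (not_lt.2 hx.1), max_eq_left ((min_le_left _ _).trans hx.2)]
  have hr : ∫ x in w..b, cdf (sellerMeasure k w b) x * secondTail k (cdf F x) =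
      ∫ x in w..b, sellerCdf k w b x * secondTail k (cdf F x) := by
    refine intervalIntegral.integral_congr fun x hx => ?_
    rw [uIcc_of_le hwb] at hx
    rw [hQ, if_neg (not_lt.2 (hw.le.trans hx.1)), min_eq_left hx.2, max_eq_right hx.1]
  have iQ : ∀ s t, IntervalIntegrable
      (fun x => cdf (sellerMeasure k w b) x * secondTail k (cdf F x)) volume s t := by
    intro s t
    obtain ⟨C, hC⟩ := exists_bound_comp_cdf (continuous_secondTail k) F
    have : ∀ μ : Measure ℝ, IsFiniteMeasure μ → Integrable
        (fun x => cdf (sellerMeasure k w b) x * secondTail k (cdf F x)) μ := fun μ _ =>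
      (integrable_comp_cdf continuous_id (sellerMeasure k w b) μ).mul_bdd
        (((continuous_secondTail k).measurable.comp (measurable_cdf F)).aestronglyMeasurable)
        (Filter.Eventually.of_forall hC)
    exact ⟨this _ inferInstance, this _ inferInstance⟩
  rw [revenue_eq (by omega) hwin hb.le hF.2.1 (sellerMeasure_mem hk hw hwb),
    integral_sellerMeasure_mul hk hw hwb, ← intervalIntegral.integral_add_adjacent_intervals
      (iQ 0 w) (iQ w b), hl, hr,
    intervalIntegral.integral_add ((iH 0 w).const_mul _) ((iF 0 w).const_mul _),
    intervalIntegral.integral_add (i1.add i2) ((iF w b).const_mul _),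
    intervalIntegral.integral_add i1 i2, hm,
    ← intervalIntegral.integral_add_adjacent_intervals (iF 0 w) (iF w b)]
  simp only [intervalIntegral.integral_const_mul]
  ring

theorem adversaryMeasure_mem (hk : 2 ≤ k) (hv : 0 ≤ v₀) (hvw : v₀ ≤ w) (hw : 0 < w)
    (hwb : w ≤ b) {m : ℝ}
    (hm : (1 - 1 / (k : ℝ) ^ 2) * v₀ + w / (k : ℝ) ^ 2 * Real.log (b / w) + w / (k : ℝ) ^ 2 = m) :
    adversaryMeasure k v₀ w b ∈ Compatible m b :=
  ⟨isProbabilityMeasure_adversaryMeasure (by omega) hw hwb, adversaryMeasure_compl hv hvw hw hwb,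
    by rw [integral_adversaryMeasure (by omega) hw hwb, hm]⟩

/-- Both laws have mean `m`, so adding the multiplier term shifts both revenues equally, and the
Lagrangian integrands can be compared point by point. -/
theorem revenue_adversaryMeasure_le (hk : 2 ≤ k) (hv : 0 ≤ v₀) (hvw : v₀ ≤ w) (hw : 0 < w)
    (hwb : w ≤ b) {winner : (Fin (k + 1) → ℝ) → Fin (k + 1)} (hwin : IsTieBreaking winner) {m : ℝ}
    (hm : (1 - 1 / (k : ℝ) ^ 2) * v₀ + w / (k : ℝ) ^ 2 * Real.log (b / w) + w / (k : ℝ) ^ 2 = m)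
    {F : Measure ℝ} (hF : F ∈ Compatible m b) :
    revenue winner (adversaryMeasure k v₀ w b) (sellerMeasure k w b) ≤
      revenue winner F (sellerMeasure k w b) := by
  have hA := adversaryMeasure_mem hk hv hvw hw hwb hm
  rw [← add_le_add_iff_right ((k + 1) * sellerScale k w b * (b - m)),
    revenue_sellerMeasure hk hw hwb hwin hA, revenue_sellerMeasure hk hw hwb hwin hF]
  have hcdf := cdf_adversaryMeasure (v₀ := v₀) (show 1 ≤ k by omega) hw hwb hvw
  have i0 : ∀ G : Measure ℝ, IntervalIntegrable (fun x => sellerCdf k w b w *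
      secondTail k (cdf G x) + (k + 1) * sellerScale k w b * cdf G x) volume 0 w := fun G =>
    ((intervalIntegrable_comp_cdf (continuous_secondTail k) G 0 w).const_mul _).add
      ((intervalIntegrable_comp_cdf continuous_id G 0 w).const_mul _)
  have i1 : ∀ G : Measure ℝ, IntervalIntegrable (fun x =>
      x * sellerDensity k w b x * (1 - cdf G x ^ (k + 1)) +
        sellerCdf k w b x * secondTail k (cdf G x) + (k + 1) * sellerScale k w b * cdf G x)
      volume w b := by
    intro G
    refine (IntervalIntegrable.add ?_ ?_).add
      ((intervalIntegrable_comp_cdf continuous_id G w b).const_mul _)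
    · refine (intervalIntegrable_comp_cdf (g := fun y => 1 - y ^ (k + 1)) (by fun_prop) G w
        b).continuousOn_mul ?_
      rw [uIcc_of_le hwb]
      exact continuousOn_id.mul (continuousOn_sellerDensity hk hw)
    · refine (intervalIntegrable_comp_cdf (continuous_secondTail k) G w b).continuousOn_mul ?_
      rw [uIcc_of_le hwb]
      exact continuousOn_sellerCdf hk hw
  refine add_le_add ?_ ?_
  · refine intervalIntegral.integral_mono_on_of_le_Ioo hw.le (i0 _) (i0 _) fun x hx => ?_
    rw [hcdf]
    by_cases h : x < v₀
    · rw [if_pos h, atom_lagrangian_zero hk hw]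
      exact atom_lagrangian_le hk hw hwb (cdf_nonneg F x)
    · rw [if_neg h, if_pos hx.2]
      exact atom_lagrangian_le hk hw hwb (cdf_nonneg F x)
  -- The open interval is needed: at `x = b` the atom lifts the distribution function to `1`, away
  -- from the minimizer.
  · refine intervalIntegral.integral_mono_on_of_le_Ioo hwb (i1 _) (i1 _) fun x hx => ?_
    rw [hcdf, if_neg (not_lt.2 (hvw.trans hx.1.le)), if_neg (not_lt.2 hx.1.le), if_pos hx.2]
    exact lagrangian_le hk hw hwb hx.1.le (cdf_nonneg F x)

end RobustAuction

/-! ### The seller's best response and the saddle point -/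

namespace RobustAuction

variable {k : ℕ} {v₀ w b r : ℝ}

/-- With `u = 1 - a / x`, the derivative is `1 - u^(k+1) - (k+1) u^k (1 - u)`. Along the
equal-revenue part, the two terms of `revenueAt_eq` therefore have opposite derivatives in `r`, and
revenue is constant. -/
theorem hasDerivAt_mul_one_sub_pow (k : ℕ) (a : ℝ) {x : ℝ} (hx : x ≠ 0) :
    HasDerivAt (fun x => x * (1 - (1 - a / x) ^ (k + 1))) (secondTail k (1 - a / x)) x := by
  have h1 : HasDerivAt (fun x => 1 - a / x) (a / x ^ 2) x := by
    simpa [sub_eq_add_neg] using (hasDerivAt_neg_div a hx).const_add 1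
  refine ((hasDerivAt_id x).mul ((h1.pow (k + 1)).const_sub 1)).congr_deriv ?_
  have hax : a = x * (1 - (1 - a / x)) := by field_simp; ring
  simp only [id, Pi.pow_apply, Nat.add_sub_cancel, secondTail]
  set u := 1 - a / x with hu
  rw [hax]
  push_cast
  field_simp
  ring

theorem integral_secondTail_right (hk : 1 ≤ k) (hvw : v₀ ≤ w) (hw : 0 < w) (hr : w ≤ r)
    (hrb : r ≤ b) :
    ∫ x in r..b, secondTail k (cdf (adversaryMeasure k v₀ w b) x) =
      b * (1 - (1 - w / (k : ℝ) ^ 2 / b) ^ (k + 1)) -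
        r * (1 - (1 - w / (k : ℝ) ^ 2 / r) ^ (k + 1)) := by
  have hpos : ∀ x ∈ uIcc r b, x ≠ 0 := fun x hx => by
    rw [uIcc_of_le hrb] at hx
    exact ((hw.trans_le hr).trans_le hx.1).ne'
  rw [← intervalIntegral.integral_eq_sub_of_hasDerivAt
    (f := fun x => x * (1 - (1 - w / (k : ℝ) ^ 2 / x) ^ (k + 1)))
    (f' := fun x => secondTail k (1 - w / (k : ℝ) ^ 2 / x))
    (fun x hx => hasDerivAt_mul_one_sub_pow k _ (hpos x hx))]
  · refine intervalIntegral.integral_congr_Ioo_of_le hrb fun x hx => ?_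
    have hwx : w ≤ x := hr.trans hx.1.le
    rw [cdf_adversaryMeasure hk hw (hr.trans hrb) hvw, if_neg (not_lt.2 (hvw.trans hwx)),
      if_neg (not_lt.2 hwx), if_pos hx.2]
  · refine ContinuousOn.intervalIntegrable ?_
    exact (continuous_secondTail k).comp_continuousOn
      (continuousOn_const.sub (continuousOn_const.div continuousOn_id hpos))

theorem integral_secondTail_middle (hk : 1 ≤ k) (hvw : v₀ ≤ w) (hw : 0 < w) (hwb : w ≤ b)
    (hr : v₀ ≤ r) (hrw : r ≤ w) :
    ∫ x in r..w, secondTail k (cdf (adversaryMeasure k v₀ w b) x) =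
      (w - r) * secondTail k (1 - 1 / (k : ℝ) ^ 2) := by
  rw [← smul_eq_mul, ← intervalIntegral.integral_const]
  refine intervalIntegral.integral_congr_Ioo_of_le hrw fun x hx => ?_
  rw [cdf_adversaryMeasure hk hw hwb hvw, if_neg (not_lt.2 (hr.trans hx.1.le)), if_pos hx.2]

theorem integral_secondTail_left (hk : 1 ≤ k) (hvw : v₀ ≤ w) (hw : 0 < w) (hwb : w ≤ b)
    (hr : r ≤ v₀) :
    ∫ x in r..v₀, secondTail k (cdf (adversaryMeasure k v₀ w b) x) = v₀ - r := by
  rw [← mul_one (v₀ - r), ← smul_eq_mul, ← intervalIntegral.integral_const]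
  refine intervalIntegral.integral_congr_Ioo_of_le hr fun x hx => ?_
  rw [cdf_adversaryMeasure hk hw hwb hvw, if_pos hx.2, secondTail]
  simp [show k ≠ 0 by omega]

/-- Revenue of the reserve `0` against the adversary's distribution. -/
noncomputable def gameValue (k : ℕ) (v₀ w b : ℝ) : ℝ :=
  b * (1 - (1 - w / (k : ℝ) ^ 2 / b) ^ (k + 1)) + (1 - 1 / (k : ℝ) ^ 2) ^ k *
    (v₀ * (1 - 1 / (k : ℝ) ^ 2) - (w - v₀) * (k + 1) * (1 / (k : ℝ) ^ 2))

section Revenue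

variable {winner : (Fin (k + 1) → ℝ) → Fin (k + 1)}

theorem revenueAt_right (hk : 1 ≤ k) (hwin : IsTieBreaking winner) (hv : 0 ≤ v₀) (hvw : v₀ ≤ w)
    (hw : 0 < w) (hr : w ≤ r) (hrb : r < b) :
    revenueAt winner (adversaryMeasure k v₀ w b) r =
      b * (1 - (1 - w / (k : ℝ) ^ 2 / b) ^ (k + 1)) := by
  have hwb : w ≤ b := hr.trans hrb.le
  have := isProbabilityMeasure_adversaryMeasure (v₀ := v₀) hk hw hwb
  rw [revenueAt_eq hk hwin (adversaryMeasure_compl hv hvw hw hwb) hrb.le,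
    integral_secondTail_right hk hvw hw hr hrb.le, cdf_adversaryMeasure hk hw hwb hvw,
    if_neg (not_lt.2 (hvw.trans hr)), if_neg (not_lt.2 hr), if_pos hrb]
  ring

theorem revenueAt_middle (hk : 1 ≤ k) (hwin : IsTieBreaking winner) (hv : 0 ≤ v₀)
    (hw : 0 < w) (hwb : w ≤ b) (hr : v₀ ≤ r) (hrw : r < w) :
    revenueAt winner (adversaryMeasure k v₀ w b) r =
      b * (1 - (1 - w / (k : ℝ) ^ 2 / b) ^ (k + 1)) -
        (w - r) * (k + 1) * (1 / (k : ℝ) ^ 2) * (1 - 1 / (k : ℝ) ^ 2) ^ k := by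
  have hvw : v₀ ≤ w := hr.trans hrw.le
  have := isProbabilityMeasure_adversaryMeasure (v₀ := v₀) hk hw hwb
  have hi := fun s t => intervalIntegrable_comp_cdf (continuous_secondTail k)
    (adversaryMeasure k v₀ w b) s t
  rw [revenueAt_eq hk hwin (adversaryMeasure_compl hv hvw hw hwb) (hrw.le.trans hwb),
    ← intervalIntegral.integral_add_adjacent_intervals (hi r w) (hi w b),
    integral_secondTail_right hk hvw hw le_rfl hwb,
    integral_secondTail_middle hk hvw hw hwb hr hrw.le, cdf_adversaryMeasure hk hw hwb hvw,
    if_neg (not_lt.2 hr), if_pos hrw, one_sub_div_self hw]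
  generalize 1 / (k : ℝ) ^ 2 = s
  rw [secondTail]
  ring

theorem revenueAt_left (hk : 1 ≤ k) (hwin : IsTieBreaking winner) (hv : 0 ≤ v₀) (hvw : v₀ ≤ w)
    (hw : 0 < w) (hwb : w ≤ b) (hr : r < v₀) :
    revenueAt winner (adversaryMeasure k v₀ w b) r = gameValue k v₀ w b := by
  have := isProbabilityMeasure_adversaryMeasure (v₀ := v₀) hk hw hwb
  have hi := fun s t => intervalIntegrable_comp_cdf (continuous_secondTail k)
    (adversaryMeasure k v₀ w b) s t
  rw [revenueAt_eq hk hwin (adversaryMeasure_compl hv hvw hw hwb) ((hr.le.trans hvw).trans hwb),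
    ← intervalIntegral.integral_add_adjacent_intervals (hi r v₀) (hi v₀ b),
    ← intervalIntegral.integral_add_adjacent_intervals (hi v₀ w) (hi w b),
    integral_secondTail_right hk hvw hw le_rfl hwb,
    integral_secondTail_middle hk hvw hw hwb le_rfl hvw, integral_secondTail_left hk hvw hw hwb hr.le,
    cdf_adversaryMeasure hk hw hwb hvw, if_pos hr, one_sub_div_self hw, gameValue]
  generalize 1 / (k : ℝ) ^ 2 = s
  rw [secondTail, zero_pow (Nat.succ_ne_zero k)]
  ring

/-- Isolates `k v₀ - w`, the sign of which decides between reserve `0` and reserves in `[w, b)`. -/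
theorem gameValue_eq (hk : 2 ≤ k) :
    gameValue k v₀ w b = b * (1 - (1 - w / (k : ℝ) ^ 2 / b) ^ (k + 1)) +
      (1 - 1 / (k : ℝ) ^ 2) ^ k * ((k + 1) / (k : ℝ) ^ 2 * (k * v₀ - w)) := by
  have hk0 : (k : ℝ) ≠ 0 := by positivity
  rw [gameValue]
  congr 2
  field_simp
  ring

theorem le_gameValue (hk : 2 ≤ k) (h : w ≤ k * v₀) :
    b * (1 - (1 - w / (k : ℝ) ^ 2 / b) ^ (k + 1)) ≤ gameValue k v₀ w b := by
  rw [gameValue_eq hk, le_add_iff_nonneg_right]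
  have h1 := one_sub_inv_sq_pos hk
  have h2 := sub_nonneg.2 h
  positivity

theorem gameValue_nonneg (hk : 1 ≤ k) (hwin : IsTieBreaking winner) (hv : 0 < v₀) (hvw : v₀ ≤ w)
    (hwb : w ≤ b) : 0 ≤ gameValue k v₀ w b := by
  rw [← revenueAt_left hk hwin hv.le hvw (hv.trans_le hvw) hwb hv]
  exact revenueAt_nonneg _ _ le_rfl

theorem revenueAt_le_gameValue (hk : 2 ≤ k) (hwin : IsTieBreaking winner) (hv : 0 < v₀)
    (hvw : v₀ ≤ w) (hwb : w ≤ b) (h : w ≤ k * v₀) (hr : r ∈ Icc 0 b) :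
    revenueAt winner (adversaryMeasure k v₀ w b) r ≤ gameValue k v₀ w b := by
  have hk1 : 1 ≤ k := by omega
  have hw : 0 < w := hv.trans_le hvw
  have hV := le_gameValue (b := b) hk h
  rcases lt_or_ge r v₀ with h1 | h1
  · exact (revenueAt_left hk1 hwin hv.le hvw hw hwb h1).le
  rcases lt_or_ge r w with h2 | h2
  · rw [revenueAt_middle hk1 hwin hv.le hw hwb h1 h2]
    refine le_trans (sub_le_self _ ?_) hV
    have h3 := one_sub_inv_sq_pos hk
    have h4 := sub_nonneg.2 h2.le
    positivity
  rcases lt_or_eq_of_le hr.2 with h3 | h3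
  · rw [revenueAt_right hk1 hwin hv.le hvw hw h2 h3]
    exact hV
  -- At `r = b` no bid strictly exceeds the reserve, so revenue is `0` in spite of the atom at `b`.
  · have := isProbabilityMeasure_adversaryMeasure (v₀ := v₀) hk1 hw hwb
    have hc := adversaryMeasure_compl (k := k) hv.le hvw hw hwb
    rw [h3, revenueAt_eq hk1 hwin hc le_rfl, cdf_eq_one_of_le hc le_rfl]
    simpa using gameValue_nonneg hk1 hwin hv hvw hwb

/-- Almost every reserve in the support earns the same amount. The equality `k v₀ = w` is needed
only if `(w, b)` is nonempty, so the high regime `w = b` is exempt. -/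
theorem revenue_eq_gameValue (hk : 2 ≤ k) (hwin : IsTieBreaking winner) (hv : 0 < v₀)
    (hvw : v₀ ≤ w) (hwb : w ≤ b) (h : w < b → k * v₀ = w) :
    revenue winner (adversaryMeasure k v₀ w b) (sellerMeasure k w b) = gameValue k v₀ w b := by
  have hk1 : 1 ≤ k := by omega
  have hw : 0 < w := hv.trans_le hvw
  have := isProbabilityMeasure_sellerMeasure hk hw hwb
  have hae : ∀ᵐ r ∂sellerMeasure k w b,
      revenueAt winner (adversaryMeasure k v₀ w b) r = gameValue k v₀ w b := by
    rw [sellerMeasure, ae_add_measure_iff]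
    constructor
    · refine Measure.ae_smul_measure ?_ _
      rw [ae_dirac_eq, Filter.eventually_pure]
      exact revenueAt_left hk1 hwin hv.le hvw hw hwb hv
    · have hne : ∀ᵐ r ∂densityOn w b (sellerDensity k w b), r ≠ b :=
        (withDensity_absolutelyContinuous _ _).ae_le (ae_restrict_of_ae (Measure.ae_ne volume b))
      filter_upwards [densityOn_ae_mem, hne] with r hr hrb
      have hlt : r < b := lt_of_le_of_ne hr.2 hrb
      rw [revenueAt_right hk1 hwin hv.le hvw hw hr.1.le hlt, gameValue_eq hk,
        h (hr.1.trans hlt)]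
      ring
  rw [revenue, integral_congr_ae hae]
  simp

/-- The saddle point, for a common parametrization of both regimes of the game. -/
theorem isEquilibrium_seller_adversary (hk : 2 ≤ k) (hwin : IsTieBreaking winner) (hv : 0 < v₀)
    (hvw : v₀ ≤ w) (hwb : w ≤ b) (hwv : w ≤ k * v₀) (h : w < b → k * v₀ = w) {m : ℝ}
    (hm : (1 - 1 / (k : ℝ) ^ 2) * v₀ + w / (k : ℝ) ^ 2 * Real.log (b / w) + w / (k : ℝ) ^ 2 = m) :
    IsEquilibrium winner m b (sellerMeasure k w b) (adversaryMeasure k v₀ w b) where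
  seller_mem := sellerMeasure_mem hk (hv.trans_le hvw) hwb
  adversary_mem := adversaryMeasure_mem hk hv.le hvw (hv.trans_le hvw) hwb hm
  seller_best Q' hQ' := by
    rw [revenue_eq_gameValue hk hwin hv hvw hwb h]
    exact revenue_le_of_forall_revenueAt_le (gameValue_nonneg (by omega) hwin hv hvw hwb) hQ'
      fun r hr => revenueAt_le_gameValue hk hwin hv hvw hwb hwv hr
  adversary_best F' hF' :=
    revenue_adversaryMeasure_le hk hv.le hvw (hv.trans_le hvw) hwb hwin hm hF'

end Revenue

end RobustAuction

/-! ### The threshold equation -/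

namespace RobustAuction

section Threshold

theorem strictConcaveOn_threshold (A : ℝ) :
    StrictConcaveOn ℝ (Ici 0) fun x => A * x + Real.negMulLog x := by
  refine ConcaveOn.add_strictConcaveOn ?_ Real.strictConcaveOn_negMulLog
  exact (LinearMap.mulLeft ℝ A).concaveOn (convex_Ici 0)

theorem threshold_eq {A b x : ℝ} (hb : 0 < b) (hx : 0 < x) :
    (A + Real.log (b / x)) * x = (A + Real.log b) * x + Real.negMulLog x := by
  rw [Real.log_div hb.ne' hx.ne', Real.negMulLog]
  ring

/-- Equivalent to `log k < sinh (log k) = (k - 1/k) / 2`. It places `k² m` below the maximum `vbar *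
exp (k - 1/k)` of the threshold function. -/
theorem sq_lt_exp {k : ℕ} (hk : 2 ≤ k) : (k : ℝ) ^ 2 < Real.exp (k - 1 / k) := by
  have hk2 : (2 : ℝ) ≤ k := by exact_mod_cast hk
  have hk0 : (0 : ℝ) < k := by linarith
  have h := Real.self_lt_sinh_iff.2 (Real.log_pos (by linarith : (1 : ℝ) < k))
  rw [Real.sinh_log hk0] at h
  rw [← Real.log_lt_iff_lt_exp (by positivity), Real.log_pow, one_div]
  push_cast
  linarith

/-- A positive level below the maximum `b * exp (A - 1)` is attained exactly twice. -/
theorem exists_threshold_pair {A b L : ℝ} (hb : 0 < b) (hL : 0 < L)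
    (hLt : L < b * Real.exp (A - 1)) :
    ∃ x₁ x₂, 0 < x₁ ∧ x₁ < x₂ ∧ {x | 0 < x ∧ (A + Real.log (b / x)) * x = L} = {x₁, x₂} ∧
      (b ≤ x₁ → A * b ≤ L) := by
  set f : ℝ → ℝ := fun x => (A + Real.log b) * x + Real.negMulLog x with hf
  have hcont : Continuous f := by
    have := Real.continuous_negMulLog
    fun_prop
  have hconc : StrictConcaveOn ℝ (Ici 0) f := strictConcaveOn_threshold _
  have hfx : ∀ x, 0 < x → (A + Real.log (b / x)) * x = f x := fun x hx => threshold_eq hb hx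
  -- `c` is the maximizer, with `f c = c`, and `d` is the positive zero of `f`; the two roots lie on
  -- either side of `c`.
  set c := b * Real.exp (A - 1) with hc
  set d := b * Real.exp A with hd
  have hc0 : 0 < c := by positivity
  have hcd : c < d := by
    rw [hc, hd]; gcongr; linarith
  have hf0 : f 0 = 0 := by simp [hf]
  have hfc : f c = c := by
    have : b / c = Real.exp (1 - A) := by
      rw [hc, div_mul_eq_div_div, div_self hb.ne', one_div, ← Real.exp_neg, neg_sub]
    rw [← hfx c hc0, this, Real.log_exp]
    ring
  have hfd : f d = 0 := by
    have : b / d = Real.exp (-A) := by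
      rw [hd, div_mul_eq_div_div, div_self hb.ne', one_div, ← Real.exp_neg]
    rw [← hfx d (hc0.trans hcd), this, Real.log_exp]
    ring
  obtain ⟨x₁, hx₁, h₁⟩ := intermediate_value_Ioo hc0.le hcont.continuousOn
    (show L ∈ Ioo (f 0) (f c) by rw [hf0, hfc]; exact ⟨hL, hLt⟩)
  obtain ⟨x₂, hx₂, h₂⟩ := intermediate_value_Ioo' hcd.le hcont.continuousOn
    (show L ∈ Ioo (f d) (f c) by rw [hfd, hfc]; exact ⟨hL, hLt⟩)
  have h12 : x₁ < x₂ := hx₁.2.trans hx₂.1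
  have hx₂0 : 0 < x₂ := hx₁.1.trans h12
  -- A strictly concave function takes no value three times.
  have hno : ∀ x y z, 0 < x → x < y → y < z → f x = L → f y = L → f z = L → False := by
    intro x y z hx hxy hyz e1 e2 e3
    have := hconc.slope_anti_adjacent (show x ∈ Ici 0 from hx.le)
      (show z ∈ Ici 0 from (hx.trans (hxy.trans hyz)).le) hxy hyz
    simp [e1, e2, e3] at this
  refine ⟨x₁, x₂, hx₁.1, h12, ?_, fun hbx => ?_⟩
  · ext x
    simp only [mem_ofPred_eq, mem_insert_iff, mem_singleton_iff]
    constructor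
    · rintro ⟨hx, e⟩
      rw [hfx x hx] at e
      by_contra! hne
      rcases lt_or_gt_of_ne hne.1 with h | h
      · exact hno x x₁ x₂ hx h h12 e h₁ h₂
      rcases lt_or_gt_of_ne hne.2 with h' | h'
      · exact hno x₁ x x₂ hx₁.1 h h' h₁ e h₂
      · exact hno x₁ x₂ x hx₁.1 h12 h' h₁ h₂ e
    · rintro (rfl | rfl)
      · exact ⟨hx₁.1, (hfx _ hx₁.1).trans h₁⟩
      · exact ⟨hx₂0, (hfx _ hx₂0).trans h₂⟩
  · have hAb : A * b = f b := by
      rw [← hfx b hb, div_self hb.ne', Real.log_one, add_zero]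
    rw [hAb]
    rcases hbx.eq_or_lt with rfl | hlt
    · exact h₁.le
    -- The chord from `x₁` to `x₂` is horizontal, so the chord from `b` to `x₁` has positive slope.
    · have := hconc.slope_anti_adjacent (show b ∈ Ici 0 from hb.le)
        (show x₂ ∈ Ici 0 from hx₂0.le) hlt h12
      rw [h₁, h₂, sub_self, zero_div, lt_div_iff₀ (by linarith)] at this
      linarith

end Threshold

/-! ### Matching the stated distribution functions -/

theorem cdf_adversaryMeasure_low {k : ℕ} {w b : ℝ} (hk : 2 ≤ k) (hw : 0 < w) (hwb : w ≤ b) (v : ℝ) :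
    cdf (adversaryMeasure k (w / k) w b) v = cdfFLow (k + 1) b w v := by
  have hk2 : (2 : ℝ) ≤ k := by exact_mod_cast hk
  rw [cdf_adversaryMeasure (by omega) hw hwb (div_le_self hw.le (by linarith)), cdfFLow]
  simp only [Nat.cast_add, Nat.cast_one, add_sub_cancel_right]
  have : w / (k : ℝ) ^ 2 / v = w / k / (v * k) := by
    rw [div_div, div_div]; ring
  rw [this]

theorem cdf_sellerMeasure_low {k : ℕ} {w b : ℝ} (hk : 2 ≤ k) (hw : 0 < w) (hwb : w ≤ b) (r : ℝ) :
    cdf (sellerMeasure k w b) r = cdfQLow (k + 1) b w r := by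
  have hk2 : (2 : ℝ) ≤ k := by exact_mod_cast hk
  have hk0 : (0 : ℝ) < k := by linarith
  have hb : 0 < b := hw.trans_le hwb
  rw [cdf_sellerMeasure hk hw hwb, cdfQLow]
  simp only [Nat.cast_add, Nat.cast_one, add_sub_cancel_right, Nat.add_sub_cancel]
  have e1 : w / k / (b * k) = w / (k : ℝ) ^ 2 / b := by
    rw [div_div, div_div]; ring
  -- `y` is left free because the stated formula writes this inverse differently below `w` and on
  -- `[w, b]`.
  have key : ∀ x, w ≤ x → ∀ y, y = (1 - w / (k : ℝ) ^ 2 / x)⁻¹ →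
      sellerCdf k w b x = (1 - w / (k : ℝ) ^ 2 / b) ^ k * y ^ k *
        (((k : ℝ) - 1 / k + Real.log (x / w)) / ((k : ℝ) - 1 / k + Real.log (b / w))) := by
    rintro x hx y rfl
    rw [sellerCdf, sellerScale, inv_pow]
    ring
  rw [e1]
  split_ifs with h1 h2 h3
  · rfl
  · rw [max_eq_left ((min_le_left _ _).trans h2.le),
      key w le_rfl ((k : ℝ) ^ 2 / ((k : ℝ) ^ 2 - 1)), div_self hw.ne', Real.log_one, add_zero]
    rw [one_sub_div_self hw, one_sub_div (by positivity), inv_div]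
  · have hr : w ≤ r := not_lt.1 h2
    have hr0 : 0 < r := hw.trans_le hr
    rw [min_eq_left h3, max_eq_right hr, key r hr (k * r / (k * r - w / k))]
    have : 1 - w / (k : ℝ) ^ 2 / r = (k * r - w / k) / (k * r) := by field_simp
    rw [this, inv_div]
  · rw [min_eq_right (not_le.1 h3).le, max_eq_right hwb, sellerCdf_right hk hw hwb]

theorem cdf_adversaryMeasure_high {k : ℕ} {m b : ℝ} (hk : 2 ≤ k) (hb : 0 < b)
    (hv : m - (b - m) / ((k : ℝ) ^ 2 - 1) ≤ b) (v : ℝ) :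
    cdf (adversaryMeasure k (m - (b - m) / ((k : ℝ) ^ 2 - 1)) b b) v = cdfFHigh (k + 1) m b v := by
  rw [cdf_adversaryMeasure (by omega) hb le_rfl hv, cdfFHigh]
  simp only [Nat.cast_add, Nat.cast_one, add_sub_cancel_right]
  split_ifs <;> rfl

theorem cdf_sellerMeasure_high {k : ℕ} {b : ℝ} (hk : 2 ≤ k) (hb : 0 < b) (r : ℝ) :
    cdf (sellerMeasure k b b) r = cdfQHigh r := by
  rw [cdf_sellerMeasure hk hb le_rfl, cdfQHigh, max_eq_left (min_le_right _ _),
    sellerCdf_right hk hb le_rfl]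

end RobustAuction

/-! ### Assembling the two regimes -/

theorem theorem3 (n : ℕ) (hn : 3 ≤ n) (m vbar : ℝ) (hm : 0 < m) (hmv : m ≤ vbar)
    (winner : (Fin n → ℝ) → Fin n) (hwinner : RobustAuction.IsTieBreaking winner) :
    ∃ vlow vhigh : ℝ, vlow < vhigh ∧
      RobustAuction.thresholdSolutions n m vbar = {vlow, vhigh} ∧
      (vlow ≤ vbar → ∃ Q F : Measure ℝ,
        (∀ v, cdf F v = RobustAuction.cdfFLow n vbar vlow v) ∧
        (∀ r, cdf Q r = RobustAuction.cdfQLow n vbar vlow r) ∧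
        RobustAuction.IsEquilibrium winner m vbar Q F ∧
        RobustAuction.SolvesReducedProblem winner m vbar Q F) ∧
      (vbar ≤ vlow → ∃ Q F : Measure ℝ,
        (∀ v, cdf F v = RobustAuction.cdfFHigh n m vbar v) ∧
        (∀ r, cdf Q r = RobustAuction.cdfQHigh r) ∧
        RobustAuction.IsEquilibrium winner m vbar Q F ∧
        RobustAuction.SolvesReducedProblem winner m vbar Q F) := by
  obtain ⟨k, rfl⟩ : ∃ k, n = k + 1 := ⟨n - 1, by omega⟩
  have hk : 2 ≤ k := by omega
  have hk2 : (2 : ℝ) ≤ k := by exact_mod_cast hk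
  have hk0 : (0 : ℝ) < k := by linarith
  have hb : 0 < vbar := hm.trans_le hmv
  obtain ⟨w, w', hw, hww', hset, hhigh⟩ := RobustAuction.exists_threshold_pair
    (A := (k : ℝ) + 1 - 1 / k) (b := vbar) (L := (k : ℝ) ^ 2 * m) hb (by positivity) (by
      have h := RobustAuction.sq_lt_exp hk
      have e : (k : ℝ) + 1 - 1 / k - 1 = k - 1 / k := by ring
      rw [e]
      nlinarith)
  have hsol : RobustAuction.thresholdSolutions (k + 1) m vbar = {w, w'} := by
    rw [← hset, RobustAuction.thresholdSolutions]
    simp only [Nat.cast_add, Nat.cast_one, add_sub_cancel_right]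
  refine ⟨w, w', hww', hsol, fun hwb => ?_, fun hbw => ?_⟩
  · have hmem : w ∈ {x | 0 < x ∧
        ((k : ℝ) + 1 - 1 / k + Real.log (vbar / x)) * x = (k : ℝ) ^ 2 * m} := by
      rw [hset]; exact Or.inl rfl
    have heq : RobustAuction.IsEquilibrium winner m vbar (RobustAuction.sellerMeasure k w vbar)
        (RobustAuction.adversaryMeasure k (w / k) w vbar) := by
      have hkv : k * (w / k) = w := mul_div_cancel₀ w hk0.ne'
      refine RobustAuction.isEquilibrium_seller_adversary hk hwinner (by positivity)
        (div_le_self hw.le (by linarith)) hwb hkv.ge (fun _ => hkv) ?_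
      have h2 := hmem.2
      field_simp at h2 ⊢
      linear_combination h2
    exact ⟨_, _, RobustAuction.cdf_adversaryMeasure_low hk hw hwb,
      RobustAuction.cdf_sellerMeasure_low hk hw hwb, heq,
      heq.solvesReducedProblem (by omega) hwinner hb.le⟩
  · have hA := hhigh hbw
    have hk3 : 0 < (k : ℝ) ^ 2 - 1 := by nlinarith
    set v₀ := m - (vbar - m) / ((k : ℝ) ^ 2 - 1) with hv₀
    have hv₀' : ((k : ℝ) ^ 2 - 1) * v₀ = (k : ℝ) ^ 2 * m - vbar := by
      rw [hv₀]; field_simp; ring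
    have hvb : v₀ ≤ vbar := by
      have : 0 ≤ (vbar - m) / ((k : ℝ) ^ 2 - 1) := div_nonneg (by linarith) hk3.le
      linarith
    have hbv : vbar ≤ k * v₀ := by
      -- `hA` says that the threshold function at `vbar` is at most `k² m`; subtracting `vbar` from
      -- both sides gives this, and `k - 1/k = (k² - 1)/k` then yields `vbar ≤ k v₀`.
      have h1 : (k - 1 / k) * vbar ≤ ((k : ℝ) ^ 2 - 1) * v₀ := by
        rw [hv₀']; linear_combination hA
      have h2 : ((k : ℝ) - 1 / k) * vbar = ((k : ℝ) ^ 2 - 1) * (vbar / k) := by field_simp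
      rw [h2] at h1
      have h3 := le_of_mul_le_mul_left h1 hk3
      rw [div_le_iff₀ hk0] at h3
      linarith
    have hv0 : 0 < v₀ := by
      by_contra! h
      nlinarith
    have heq : RobustAuction.IsEquilibrium winner m vbar (RobustAuction.sellerMeasure k vbar vbar)
        (RobustAuction.adversaryMeasure k v₀ vbar vbar) := by
      refine RobustAuction.isEquilibrium_seller_adversary hk hwinner hv0 hvb le_rfl hbv
        (fun h => absurd h (lt_irrefl _)) ?_
      rw [div_self hb.ne', Real.log_one]
      field_simp
      linear_combination hv₀'
    exact ⟨_, _, RobustAuction.cdf_adversaryMeasure_high hk hb hvb,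
      RobustAuction.cdf_sellerMeasure_high hk hb, heq,
      heq.solvesReducedProblem (by omega) hwinner hb.le⟩
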